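/- Let $q>0$ be real, $h=\sqrt q-1/\sqrt q$, and let all indices run over $-,0,+$. Let $g_{ij}=g^{ij}$ be the matrix with nonzero entries $g_{-+}=1/\sqrt q$, $g_{00}=1$, $g_{+-}=\sqrt q$, and let $\hat R=q\mathcal P_s-q^{-1}\mathcal P_a+q^{-2}\mathcal P_t$ be the braid matrix of $SO_q(3)$, where $\mathcal P_t{}^{ij}_{kl}\propto g^{ij}g_{kl}$, $\mathcal P_a$ is the symmetric rank 3 projector whose rows span the relations $x^-x^0-q\,x^0x^-$, $x^0x^+-q\,x^+x^0$, $x^+x^--x^-x^+-h(x^0)^2$, and $\mathcal P_s=1-\mathcal P_a-\mathcal P_t$. (Repeated indices are summed.) Let $\Omega^*(\mathcal A)$ be the complex differential calculus of the quantum Euclidean space $\mathbf R^3_q$ extended by $\Lambda^{\pm1}$, $r^{\pm1}$, $(x^0)^{-1}$. That is, it is the algebra generated by $x^i$, $\Lambda^{\pm1}$, $r^{\pm1}$, $(x^0)^{-1}$ (which generate $\mathcal A=\Omega^0(\mathcal A)$) and by $\xi^i=dx^i$, with relations $x^-x^0=q\,x^0x^-$, $x^+x^0=q^{-1}x^0x^+$,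 $[x^+,x^-]=h(x^0)^2$; $x^i\xi^j=q\hat R^{ij}_{kl}\xi^kx^l$; $\mathcal P_s\xi\xi=\mathcal P_t\xi\xi=0$; $x^i\Lambda=q\Lambda x^i$, $\xi^i\Lambda=q\Lambda\xi^i$, $r\Lambda=q\Lambda r$; $r^2=g_{ij}x^ix^j$, $rx^i=x^ir$, $r\xi^i=q\,\xi^ir$; and with $\Lambda\Lambda^{-1}=\Lambda^{-1}\Lambda=1$, $rr^{-1}=r^{-1}r=1$, $x^0(x^0)^{-1}=(x^0)^{-1}x^0=1$. Here $d\Lambda=0$. Let $\theta^a=\Lambda^{-1}\theta^a_i\xi^i$ be the frame with $$\|\theta^a_i\|=\begin{pmatrix}(x^0)^{-1}&0&0\\ \sqrt q(q+1)(rx^0)^{-1}x^+&r^{-1}&0\\ -\sqrt q\,q(q+1)(r^2x^0)^{-1}(x^+)^2&-(q+1)r^{-2}x^+&r^{-2}x^0\end{pmatrix}.$$ Then for either sign convention $\varepsilon\in\{1,-1\}$ there is exactly one antilinear map $\star:\Omega^*(\mathcal A)\to\Omega^*(\mathcal A)$ such that $\star\star=\mathrm{id}$, $\Omega^p(\mathcal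 A)^\star\subseteq\Omega^p(\mathcal A)$ for all $p$, $(\omega\eta)^\star=\varepsilon^{pp'}\eta^\star\omega^\star$ for $\omega\in\Omega^p(\mathcal A)$, $\eta\in\Omega^{p'}(\mathcal A)$, and $$(x^i)^\star=x^jg_{ji},\qquad r^\star=r,\qquad \Lambda^\star=\Lambda^{-1},\qquad(\theta^a)^\star=\theta^bg_{ba}.$$ On the $\xi^i$ it is given by $(\xi^i)^\star=\Lambda^{-2}\xi^jc_{ji}$, where the $c_{ji}$ lie in the subalgebra of $\mathcal A$ generated by $x^i$, $(x^0)^{-1}$, $r^{\pm1}$ (without $\Lambda$). It acts nonlinearly on them: no $(\xi^i)^\star$ is a complex linear combination of the $\xi^j$, and no $(\xi^i)^\star$ is a complex linear combination of the $\Lambda^{-2}\xi^j$ (so the $c_{ji}$ cannot be taken constant). -/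

import Mathlib

/-!
The quantum Euclidean space with parameter `q > 0`, its `SO_q(3)`-covariant differential calculus,
and the extension of the calculus by `Λ`, `Λ⁻¹`, `r`, `r⁻¹`, `(x⁰)⁻¹`.
The indices `-, 0, +` are the elements `0, 1, 2` of `Fin 3`.
-/

noncomputable section

namespace QEucl

/-- The constant `h = √q - 1/√q`. -/
def h (q : ℝ) : ℝ := √q - 1 / √q

/-- The `SO_q(3)`-covariant metric matrix `g_{ij} = g^{ij}`. -/
def g (q : ℝ) : Matrix (Fin 3) (Fin 3) ℝ :=
  !![0, 0, 1 / √q; 0, 1, 0; √q, 0, 0]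

/-- The metric as a vector of the tensor square of the fundamental corepresentation. -/
def gVec (q : ℝ) : Fin 3 × Fin 3 → ℝ := fun p => g q p.1 p.2

/-- The coefficient vectors of the three quadratic relations of the quantum Euclidean space,
`x⁻x⁰ - q x⁰x⁻`, `x⁰x⁺ - q x⁺x⁰` and `x⁺x⁻ - x⁻x⁺ - h x⁰x⁰`. -/
def relVec (q : ℝ) : Fin 3 → Fin 3 × Fin 3 → ℝ := fun m p =>
  (![!![0, 1, 0; -q, 0, 0; 0, 0, 0],
     !![0, 0, 0; 0, 0, 1; 0, -q, 0],
     !![0, 0, -1; 0, -h q, 0; 1, 0, 0]] m : Matrix (Fin 3) (Fin 3) ℝ) p.1 p.2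

/-- The rank one symmetric projector onto the line of `v`. -/
def lineProj (v : Fin 3 × Fin 3 → ℝ) : Matrix (Fin 3 × Fin 3) (Fin 3 × Fin 3) ℝ :=
  (v ⬝ᵥ v)⁻¹ • Matrix.vecMulVec v v

/-- The `q`-deformed antisymmetric projector (the vectors `relVec q m` are pairwise orthogonal). -/
def Pa (q : ℝ) : Matrix (Fin 3 × Fin 3) (Fin 3 × Fin 3) ℝ := ∑ m, lineProj (relVec q m)

/-- The `q`-deformed trace projector, proportional to `g^{ij} g_{kl}`. -/
def Pt (q : ℝ) : Matrix (Fin 3 × Fin 3) (Fin 3 × Fin 3) ℝ := lineProj (gVec q)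

/-- The `q`-deformed symmetric trace-free projector. -/
def Ps (q : ℝ) : Matrix (Fin 3 × Fin 3) (Fin 3 × Fin 3) ℝ := 1 - Pa q - Pt q

/-- The braid matrix `R̂` of `SO_q(3)`; the entry `R̂^{ij}_{kl}` is `Rhat q (i, j) (k, l)`. -/
def Rhat (q : ℝ) : Matrix (Fin 3 × Fin 3) (Fin 3 × Fin 3) ℝ :=
  q • Ps q - q⁻¹ • Pa q + (q ^ 2)⁻¹ • Pt q

/-- Generators of the extended calculus; `dx i` becomes the 1-form `ξ^i`. -/
inductive Gen : Type
  | x (i : Fin 3)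
  | x0inv
  | r
  | rinv
  | lam
  | laminv
  | dx (i : Fin 3)

/-- The free algebra on the generators. -/
abbrev Free : Type := FreeAlgebra ℂ Gen

/-- A generator as an element of the free algebra. -/
abbrev gen (a : Gen) : Free := FreeAlgebra.ι ℂ a

/-- The defining relations of the extended differential calculus `Ω^*(A)`. -/
inductive Rel (q : ℝ) : Free → Free → Prop
  | x_minus_zero : Rel q (gen (.x 0) * gen (.x 1)) ((q : ℂ) • (gen (.x 1) * gen (.x 0)))
  | x_plus_zero : Rel q (gen (.x 2) * gen (.x 1)) ((q : ℂ)⁻¹ • (gen (.x 1) * gen (.x 2)))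
  | x_plus_minus : Rel q (gen (.x 2) * gen (.x 0) - gen (.x 0) * gen (.x 2))
      ((h q : ℂ) • (gen (.x 1) * gen (.x 1)))
  | x_dx (i j : Fin 3) : Rel q (gen (.x i) * gen (.dx j))
      ((q : ℂ) • ∑ k, ∑ l, (Rhat q (i, j) (k, l) : ℂ) • (gen (.dx k) * gen (.x l)))
  | dx_dx_s (i j : Fin 3) :
      Rel q (∑ k, ∑ l, (Ps q (i, j) (k, l) : ℂ) • (gen (.dx k) * gen (.dx l))) 0
  | dx_dx_t (i j : Fin 3) :
      Rel q (∑ k, ∑ l, (Pt q (i, j) (k, l) : ℂ) • (gen (.dx k) * gen (.dx l))) 0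
  | x_lam (i : Fin 3) : Rel q (gen (.x i) * gen .lam) ((q : ℂ) • (gen .lam * gen (.x i)))
  | dx_lam (i : Fin 3) : Rel q (gen (.dx i) * gen .lam) ((q : ℂ) • (gen .lam * gen (.dx i)))
  | r_lam : Rel q (gen .r * gen .lam) ((q : ℂ) • (gen .lam * gen .r))
  | lam_laminv : Rel q (gen .lam * gen .laminv) 1
  | laminv_lam : Rel q (gen .laminv * gen .lam) 1
  | r_sq : Rel q (gen .r * gen .r) (∑ i, ∑ j, (g q i j : ℂ) • (gen (.x i) * gen (.x j)))
  | r_x (i : Fin 3) : Rel q (gen .r * gen (.x i)) (gen (.x i) * gen .r)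
  | r_dx (i : Fin 3) : Rel q (gen .r * gen (.dx i)) ((q : ℂ) • (gen (.dx i) * gen .r))
  | r_rinv : Rel q (gen .r * gen .rinv) 1
  | rinv_r : Rel q (gen .rinv * gen .r) 1
  | x0_x0inv : Rel q (gen (.x 1) * gen .x0inv) 1
  | x0inv_x0 : Rel q (gen .x0inv * gen (.x 1)) 1

/-- The extended differential calculus `Ω^*(A)` as an algebra. -/
def Omega (q : ℝ) : Type := RingQuot (Rel q)

instance (q : ℝ) : Ring (Omega q) := inferInstanceAs (Ring (RingQuot (Rel q)))

instance (q : ℝ) : Algebra ℂ (Omega q) := inferInstanceAs (Algebra ℂ (RingQuot (Rel q)))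

/-- The quotient map from the free algebra. -/
def mk (q : ℝ) : Free →ₐ[ℂ] Omega q := RingQuot.mkAlgHom ℂ (Rel q)

/-- The class of a generator. -/
def cls (q : ℝ) (a : Gen) : Omega q := mk q (gen a)

/-- The coordinates `x^i`. -/
def x (q : ℝ) (i : Fin 3) : Omega q := cls q (.x i)
/-- The inverse of `x⁰`. -/
def x0inv (q : ℝ) : Omega q := cls q .x0inv
/-- The square root `r` of `g_{ij} x^i x^j`. -/
def r (q : ℝ) : Omega q := cls q .r
/-- The inverse of `r`. -/
def rinv (q : ℝ) : Omega q := cls q .rinv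
/-- The dilatation generator `Λ`. -/
def lam (q : ℝ) : Omega q := cls q .lam
/-- The inverse of `Λ`. -/
def laminv (q : ℝ) : Omega q := cls q .laminv
/-- The 1-forms `ξ^i`; the lemma `d_x` shows that `ξ^i = d x^i`. -/
def xi (q : ℝ) (i : Fin 3) : Omega q := cls q (.dx i)

/-! ### The relations as identities in `Ω^*(A)` -/

section relations

variable (q : ℝ)

theorem mk_eq {a b : Free} (hab : Rel q a b) :
    mk q a = mk q b :=
  RingQuot.mkAlgHom_rel ℂ hab

theorem mk_x (i : Fin 3) : mk q (gen (.x i)) = x q i := rfl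
theorem mk_dx (i : Fin 3) : mk q (gen (.dx i)) = xi q i := rfl
theorem mk_x0inv : mk q (gen .x0inv) = x0inv q := rfl
theorem mk_r : mk q (gen .r) = r q := rfl
theorem mk_rinv : mk q (gen .rinv) = rinv q := rfl
theorem mk_lam : mk q (gen .lam) = lam q := rfl
theorem mk_laminv : mk q (gen .laminv) = laminv q := rfl

theorem x_minus_zero : x q 0 * x q 1 = (q : ℂ) • (x q 1 * x q 0) := by
  simpa only [map_mul, map_smul, map_sum, map_zero, map_one, mk_x, mk_dx,
    mk_x0inv, mk_r, mk_rinv, mk_lam, mk_laminv] using mk_eq q .x_minus_zero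

theorem x_plus_zero : x q 2 * x q 1 = (q : ℂ)⁻¹ • (x q 1 * x q 2) := by
  simpa only [map_mul, map_smul, map_sum, map_zero, map_one, mk_x, mk_dx,
    mk_x0inv, mk_r, mk_rinv, mk_lam, mk_laminv] using mk_eq q .x_plus_zero

theorem x_plus_minus : x q 2 * x q 0 = x q 0 * x q 2 + (h q : ℂ) • (x q 1 * x q 1) := by
  have := mk_eq q .x_plus_minus
  simp only [map_sub, map_mul, map_smul, mk_x] at this
  exact sub_eq_iff_eq_add'.mp this

theorem x_xi (i j : Fin 3) : x q i * xi q j =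
    (q : ℂ) • ∑ k, ∑ l, (Rhat q (i, j) (k, l) : ℂ) • (xi q k * x q l) := by
  simpa only [map_mul, map_smul, map_sum, map_zero, map_one, mk_x, mk_dx,
    mk_x0inv, mk_r, mk_rinv, mk_lam, mk_laminv] using mk_eq q (.x_dx i j)

theorem xi_xi_s (i j : Fin 3) :
    ∑ k, ∑ l, (Ps q (i, j) (k, l) : ℂ) • (xi q k * xi q l) = 0 := by
  simpa only [map_mul, map_smul, map_sum, map_zero, map_one, mk_x, mk_dx,
    mk_x0inv, mk_r, mk_rinv, mk_lam, mk_laminv] using mk_eq q (.dx_dx_s i j)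

theorem xi_xi_t (i j : Fin 3) :
    ∑ k, ∑ l, (Pt q (i, j) (k, l) : ℂ) • (xi q k * xi q l) = 0 := by
  simpa only [map_mul, map_smul, map_sum, map_zero, map_one, mk_x, mk_dx,
    mk_x0inv, mk_r, mk_rinv, mk_lam, mk_laminv] using mk_eq q (.dx_dx_t i j)

theorem x_lam (i : Fin 3) : x q i * lam q = (q : ℂ) • (lam q * x q i) := by
  simpa only [map_mul, map_smul, map_sum, map_zero, map_one, mk_x, mk_dx,
    mk_x0inv, mk_r, mk_rinv, mk_lam, mk_laminv] using mk_eq q (.x_lam i)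

theorem xi_lam (i : Fin 3) : xi q i * lam q = (q : ℂ) • (lam q * xi q i) := by
  simpa only [map_mul, map_smul, map_sum, map_zero, map_one, mk_x, mk_dx,
    mk_x0inv, mk_r, mk_rinv, mk_lam, mk_laminv] using mk_eq q (.dx_lam i)

theorem r_lam : r q * lam q = (q : ℂ) • (lam q * r q) := by
  simpa only [map_mul, map_smul, map_sum, map_zero, map_one, mk_x, mk_dx,
    mk_x0inv, mk_r, mk_rinv, mk_lam, mk_laminv] using mk_eq q .r_lam

theorem lam_laminv : lam q * laminv q = 1 := by simpa only [map_mul, map_smul, map_sum, map_zero, map_one, mk_x, mk_dx,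
    mk_x0inv, mk_r, mk_rinv, mk_lam, mk_laminv] using mk_eq q .lam_laminv

theorem laminv_lam : laminv q * lam q = 1 := by simpa only [map_mul, map_smul, map_sum, map_zero, map_one, mk_x, mk_dx,
    mk_x0inv, mk_r, mk_rinv, mk_lam, mk_laminv] using mk_eq q .laminv_lam

theorem r_sq : r q * r q = ∑ i, ∑ j, (g q i j : ℂ) • (x q i * x q j) := by
  simpa only [map_mul, map_smul, map_sum, map_zero, map_one, mk_x, mk_dx,
    mk_x0inv, mk_r, mk_rinv, mk_lam, mk_laminv] using mk_eq q .r_sq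

theorem r_x (i : Fin 3) : r q * x q i = x q i * r q := by simpa only [map_mul, map_smul, map_sum, map_zero, map_one, mk_x, mk_dx,
    mk_x0inv, mk_r, mk_rinv, mk_lam, mk_laminv] using mk_eq q (.r_x i)

theorem r_xi (i : Fin 3) : r q * xi q i = (q : ℂ) • (xi q i * r q) := by
  simpa only [map_mul, map_smul, map_sum, map_zero, map_one, mk_x, mk_dx,
    mk_x0inv, mk_r, mk_rinv, mk_lam, mk_laminv] using mk_eq q (.r_dx i)

theorem r_rinv : r q * rinv q = 1 := by simpa only [map_mul, map_smul, map_sum, map_zero, map_one, mk_x, mk_dx,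
    mk_x0inv, mk_r, mk_rinv, mk_lam, mk_laminv] using mk_eq q .r_rinv

theorem rinv_r : rinv q * r q = 1 := by simpa only [map_mul, map_smul, map_sum, map_zero, map_one, mk_x, mk_dx,
    mk_x0inv, mk_r, mk_rinv, mk_lam, mk_laminv] using mk_eq q .rinv_r

theorem x0_x0inv : x q 1 * x0inv q = 1 := by simpa only [map_mul, map_smul, map_sum, map_zero, map_one, mk_x, mk_dx,
    mk_x0inv, mk_r, mk_rinv, mk_lam, mk_laminv] using mk_eq q .x0_x0inv

theorem x0inv_x0 : x0inv q * x q 1 = 1 := by simpa only [map_mul, map_smul, map_sum, map_zero, map_one, mk_x, mk_dx,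
    mk_x0inv, mk_r, mk_rinv, mk_lam, mk_laminv] using mk_eq q .x0inv_x0

end relations

section explicit

theorem h_sq (s : ℝ) (hs : 0 < s) : h (s ^ 2) = s - 1 / s := by
  rw [h, Real.sqrt_sq hs.le]

theorem relVec_norm_zero (q : ℝ) : relVec q 0 ⬝ᵥ relVec q 0 = 1 + q ^ 2 := by
  simp [relVec, dotProduct, Fintype.sum_prod_type, Fin.sum_univ_three]; ring

theorem relVec_norm_one (q : ℝ) : relVec q 1 ⬝ᵥ relVec q 1 = 1 + q ^ 2 := by
  simp [relVec, dotProduct, Fintype.sum_prod_type, Fin.sum_univ_three]; ring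

theorem relVec_norm_two (q : ℝ) : relVec q 2 ⬝ᵥ relVec q 2 = 2 + h q ^ 2 := by
  simp [relVec, dotProduct, Fintype.sum_prod_type, Fin.sum_univ_three]; ring

theorem gVec_norm (s : ℝ) (hs : 0 < s) :
    gVec (s ^ 2) ⬝ᵥ gVec (s ^ 2) = 1 + s ^ 2 + (s ^ 2)⁻¹ := by
  simp [gVec, g, dotProduct, Fintype.sum_prod_type, Fin.sum_univ_three, Real.sqrt_sq hs.le]
  ring

/-- The entries of `P_a`. -/
theorem Pa_apply (s : ℝ) (hs : 0 < s) (a b : Fin 3 × Fin 3) : Pa (s ^ 2) a b =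
    (relVec (s ^ 2) 0 a * relVec (s ^ 2) 0 b + relVec (s ^ 2) 1 a * relVec (s ^ 2) 1 b)
        / (1 + s ^ 4) + s ^ 2 / (1 + s ^ 4) * (relVec (s ^ 2) 2 a * relVec (s ^ 2) 2 b) := by
  simp only [Pa, lineProj, Fin.sum_univ_three, relVec_norm_zero, relVec_norm_one,
    relVec_norm_two, Matrix.add_apply, Matrix.smul_apply, Matrix.vecMulVec_apply, smul_eq_mul,
    h_sq s hs]
  have : (2 + (s - 1 / s) ^ 2)⁻¹ = s ^ 2 / (1 + s ^ 4) := by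
    have h1 : 2 + (s - 1 / s) ^ 2 = (1 + s ^ 4) / s ^ 2 := by field_simp; ring
    rw [h1, inv_div]
  rw [this]
  ring

theorem Pt_apply (s : ℝ) (hs : 0 < s) (a b : Fin 3 × Fin 3) : Pt (s ^ 2) a b =
    s ^ 2 / (1 + s ^ 2 + s ^ 4) * (gVec (s ^ 2) a * gVec (s ^ 2) b) := by
  simp only [Pt, lineProj, gVec_norm s hs, Matrix.smul_apply, Matrix.vecMulVec_apply, smul_eq_mul]
  have h1 : 1 + s ^ 2 + (s ^ 2)⁻¹ = (1 + s ^ 2 + s ^ 4) / s ^ 2 := by field_simp; ring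
  rw [h1, inv_div]

theorem Rhat_eq (q : ℝ) : Rhat q = q • (1 : Matrix _ _ ℝ) - (q + q⁻¹) • Pa q
    + ((q ^ 2)⁻¹ - q) • Pt q := by
  rw [Rhat, Ps]; module

/-- The nonzero entries of `q R̂`. -/
def qRhatTable (s : ℝ) : Fin 3 → Fin 3 → Fin 3 → Fin 3 → ℝ
  | 0, 0, 0, 0 => s ^ 4
  | 0, 1, 0, 1 => s ^ 4 - 1
  | 0, 1, 1, 0 => s ^ 2
  | 0, 2, 0, 2 => (s ^ 4 - 1) * (1 - (s ^ 2)⁻¹)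
  | 0, 2, 1, 1 => -(s ^ 4 - 1) / s
  | 0, 2, 2, 0 => 1
  | 1, 0, 0, 1 => s ^ 2
  | 1, 1, 0, 2 => -(s ^ 4 - 1) / s
  | 1, 1, 1, 1 => s ^ 2
  | 1, 2, 1, 2 => s ^ 4 - 1
  | 1, 2, 2, 1 => s ^ 2
  | 2, 0, 0, 2 => 1
  | 2, 1, 1, 2 => s ^ 2
  | 2, 2, 2, 2 => s ^ 4
  | _, _, _, _ => 0

theorem qRhat_apply (s : ℝ) (hs : 0 < s) (i j k l : Fin 3) :
    s ^ 2 * Rhat (s ^ 2) (i, j) (k, l) = qRhatTable s i j k l := by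
  have e1 : (1 : ℝ) + s ^ 4 ≠ 0 := by positivity
  have e2 : (1 : ℝ) + s ^ 2 + s ^ 4 ≠ 0 := by positivity
  have e3 : s ≠ 0 := hs.ne'
  rw [Rhat_eq]
  simp only [Matrix.add_apply, Matrix.sub_apply, Matrix.smul_apply, Pa_apply s hs, Pt_apply s hs,
    smul_eq_mul, relVec, gVec, g, h_sq s hs, Real.sqrt_sq hs.le, Matrix.one_apply]
  have key (m : Fin 3) : m = 0 ∨ m = 1 ∨ m = 2 := by omega
  rcases key i with rfl | rfl | rfl <;> rcases key j with rfl | rfl | rfl <;>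
    rcases key k with rfl | rfl | rfl <;> rcases key l with rfl | rfl | rfl <;>
    simp [qRhatTable, e3] <;> field_simp <;> ring

end explicit

section explicit

theorem x_xi_table (s : ℝ) (hs : 0 < s) (i j : Fin 3) : x (s ^ 2) i * xi (s ^ 2) j =
    ∑ k, ∑ l, (qRhatTable s i j k l : ℂ) • (xi (s ^ 2) k * x (s ^ 2) l) := by
  rw [x_xi]
  simp only [Finset.smul_sum, smul_smul, ← Complex.ofReal_mul, qRhat_apply s hs]

theorem xi_xi_table (s : ℝ) (i j : Fin 3) : xi (s ^ 2) i * xi (s ^ 2) j =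
    ∑ k, ∑ l, (Pa (s ^ 2) (i, j) (k, l) : ℂ) • (xi (s ^ 2) k * xi (s ^ 2) l) := by
  have h1 : ∑ k, ∑ l, (((1 : Matrix (Fin 3 × Fin 3) (Fin 3 × Fin 3) ℝ) (i, j) (k, l) : ℝ) : ℂ) •
      (xi (s ^ 2) k * xi (s ^ 2) l) = xi (s ^ 2) i * xi (s ^ 2) j := by
    rw [← Fintype.sum_prod_type' (f := fun k l =>
      (((1 : Matrix (Fin 3 × Fin 3) (Fin 3 × Fin 3) ℝ) (i, j) (k, l) : ℝ) : ℂ) •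
      (xi (s ^ 2) k * xi (s ^ 2) l))]
    simp [Matrix.one_apply]
  have h2 := xi_xi_s (s ^ 2) i j
  have h3 := xi_xi_t (s ^ 2) i j
  simp only [Ps, Matrix.sub_apply, Complex.ofReal_sub, sub_smul, Finset.sum_sub_distrib, h1, h3,
    sub_zero] at h2
  exact sub_eq_zero.mp h2

theorem x0_xi0 (s : ℝ) (hs : 0 < s) : x (s ^ 2) 0 * xi (s ^ 2) 0 = ((s : ℂ) ^ 4) • (xi (s ^ 2) 0 * x (s ^ 2) 0) := by
  simp [x_xi_table s hs, Fin.sum_univ_three, qRhatTable, -Complex.coe_smul]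

theorem x0_xi1 (s : ℝ) (hs : 0 < s) : x (s ^ 2) 0 * xi (s ^ 2) 1 = ((s : ℂ) ^ 4 - 1) • (xi (s ^ 2) 0 * x (s ^ 2) 1)
    + ((s : ℂ) ^ 2) • (xi (s ^ 2) 1 * x (s ^ 2) 0) := by
  simp [x_xi_table s hs, Fin.sum_univ_three, qRhatTable, -Complex.coe_smul]

theorem x0_xi2 (s : ℝ) (hs : 0 < s) : x (s ^ 2) 0 * xi (s ^ 2) 2 =
    (((s : ℂ) ^ 4 - 1) * (1 - ((s : ℂ) ^ 2)⁻¹)) • (xi (s ^ 2) 0 * x (s ^ 2) 2)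
    + (-((s : ℂ) ^ 4 - 1) / s) • (xi (s ^ 2) 1 * x (s ^ 2) 1) + xi (s ^ 2) 2 * x (s ^ 2) 0 := by
  simp [x_xi_table s hs, Fin.sum_univ_three, qRhatTable, -Complex.coe_smul]

theorem x1_xi0 (s : ℝ) (hs : 0 < s) : x (s ^ 2) 1 * xi (s ^ 2) 0 = ((s : ℂ) ^ 2) • (xi (s ^ 2) 0 * x (s ^ 2) 1) := by
  simp [x_xi_table s hs, Fin.sum_univ_three, qRhatTable, -Complex.coe_smul]

theorem x1_xi1 (s : ℝ) (hs : 0 < s) : x (s ^ 2) 1 * xi (s ^ 2) 1 =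
    (-((s : ℂ) ^ 4 - 1) / s) • (xi (s ^ 2) 0 * x (s ^ 2) 2)
    + ((s : ℂ) ^ 2) • (xi (s ^ 2) 1 * x (s ^ 2) 1) := by
  simp [x_xi_table s hs, Fin.sum_univ_three, qRhatTable, -Complex.coe_smul]

theorem x1_xi2 (s : ℝ) (hs : 0 < s) : x (s ^ 2) 1 * xi (s ^ 2) 2 = ((s : ℂ) ^ 4 - 1) • (xi (s ^ 2) 1 * x (s ^ 2) 2)
    + ((s : ℂ) ^ 2) • (xi (s ^ 2) 2 * x (s ^ 2) 1) := by
  simp [x_xi_table s hs, Fin.sum_univ_three, qRhatTable, -Complex.coe_smul]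

theorem x2_xi0 (s : ℝ) (hs : 0 < s) : x (s ^ 2) 2 * xi (s ^ 2) 0 = xi (s ^ 2) 0 * x (s ^ 2) 2 := by
  simp [x_xi_table s hs, Fin.sum_univ_three, qRhatTable, -Complex.coe_smul]

theorem x2_xi1 (s : ℝ) (hs : 0 < s) : x (s ^ 2) 2 * xi (s ^ 2) 1 = ((s : ℂ) ^ 2) • (xi (s ^ 2) 1 * x (s ^ 2) 2) := by
  simp [x_xi_table s hs, Fin.sum_univ_three, qRhatTable, -Complex.coe_smul]

theorem x2_xi2 (s : ℝ) (hs : 0 < s) : x (s ^ 2) 2 * xi (s ^ 2) 2 = ((s : ℂ) ^ 4) • (xi (s ^ 2) 2 * x (s ^ 2) 2) := by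
  simp [x_xi_table s hs, Fin.sum_univ_three, qRhatTable, -Complex.coe_smul]

/-- Proportional rows of the antisymmetric projector. -/
theorem xi_xi_row (s : ℝ) (i j k l : Fin 3) (c : ℝ)
    (hc : ∀ a, Pa (s ^ 2) (i, j) a = c * Pa (s ^ 2) (k, l) a) :
    xi (s ^ 2) i * xi (s ^ 2) j = (c : ℂ) • (xi (s ^ 2) k * xi (s ^ 2) l) := by
  rw [xi_xi_table s i j, xi_xi_table s k l]
  simp only [hc, Complex.ofReal_mul, Finset.smul_sum, smul_smul]

theorem xi0_xi0 (s : ℝ) (hs : 0 < s) : xi (s ^ 2) 0 * xi (s ^ 2) 0 = 0 := by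
  have := xi_xi_row s 0 0 0 0 0 fun a => by simp [Pa_apply s hs, relVec]
  simpa using this

theorem xi2_xi2 (s : ℝ) (hs : 0 < s) : xi (s ^ 2) 2 * xi (s ^ 2) 2 = 0 := by
  have := xi_xi_row s 2 2 0 0 0 fun a => by simp [Pa_apply s hs, relVec]
  simpa using this

theorem xi1_xi0 (s : ℝ) (hs : 0 < s) : xi (s ^ 2) 1 * xi (s ^ 2) 0 =
    (-(s : ℂ) ^ 2) • (xi (s ^ 2) 0 * xi (s ^ 2) 1) := by
  have := xi_xi_row s 1 0 0 1 (-s ^ 2) fun a => by simp [Pa_apply s hs, relVec]; ring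
  simpa using this

theorem xi2_xi1 (s : ℝ) (hs : 0 < s) : xi (s ^ 2) 2 * xi (s ^ 2) 1 =
    (-(s : ℂ) ^ 2) • (xi (s ^ 2) 1 * xi (s ^ 2) 2) := by
  have := xi_xi_row s 2 1 1 2 (-s ^ 2) fun a => by simp [Pa_apply s hs, relVec]; ring
  simpa using this

theorem xi2_xi0 (s : ℝ) (hs : 0 < s) : xi (s ^ 2) 2 * xi (s ^ 2) 0 =
    (-1 : ℂ) • (xi (s ^ 2) 0 * xi (s ^ 2) 2) := by
  have := xi_xi_row s 2 0 0 2 (-1) fun a => by simp [Pa_apply s hs, relVec]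
  simpa using this

theorem xi1_xi1 (s : ℝ) (hs : 0 < s) : xi (s ^ 2) 1 * xi (s ^ 2) 1 =
    ((s : ℂ) - 1 / s) • (xi (s ^ 2) 0 * xi (s ^ 2) 2) := by
  have := xi_xi_row s 1 1 0 2 (s - 1 / s) fun a => by
    simp [Pa_apply s hs, relVec, h_sq s hs]; ring
  simpa using this

end explicit

section differential

set_option linter.unusedSimpArgs false
set_option linter.unnecessarySeqFocus false

/-- The 1-form `g_{ij} x^i ξ^j`. -/
def rho (q : ℝ) : Omega q := ∑ i, ∑ j, (g q i j : ℂ) • (x q i * xi q j)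

/-- The differential of a generator: `d x^i = ξ^i`, `d ξ^i = 0`, `d Λ = 0`,
`d r = q r⁻¹ g_{ij} x^i ξ^j`, and the forced values on the inverses. -/
def dGen (q : ℝ) : Gen → Omega q
  | .x i => xi q i
  | .x0inv => -(x0inv q * xi q 1 * x0inv q)
  | .r => (q : ℂ) • (rinv q * rho q)
  | .rinv => -(rinv q * ((q : ℂ) • (rinv q * rho q)) * rinv q)
  | .lam => 0
  | .laminv => 0
  | .dx _ => 0

/-- The grading sign on a generator. -/
def sGen (q : ℝ) : Gen → Omega q
  | .dx i => -xi q i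
  | a => cls q a

/-- An upper triangular `2 × 2` matrix of forms. -/
def tri (q : ℝ) (a b c : Omega q) : Matrix (Fin 2) (Fin 2) (Omega q) := !![a, b; 0, c]

variable {q : ℝ}

theorem tri_mul (a b c a' b' c' : Omega q) :
    tri q a b c * tri q a' b' c' = tri q (a * a') (a * b' + b * c') (c * c') := by
  simp [tri]

theorem tri_add (a b c a' b' c' : Omega q) :
    tri q a b c + tri q a' b' c' = tri q (a + a') (b + b') (c + c') := by
  ext i j; fin_cases i <;> fin_cases j <;> simp [tri]

theorem tri_sub (a b c a' b' c' : Omega q) :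
    tri q a b c - tri q a' b' c' = tri q (a - a') (b - b') (c - c') := by
  ext i j; fin_cases i <;> fin_cases j <;> simp [tri]

theorem tri_smul (k : ℂ) (a b c : Omega q) :
    k • tri q a b c = tri q (k • a) (k • b) (k • c) := by
  ext i j; fin_cases i <;> fin_cases j <;> simp [tri]

theorem tri_sum {ι : Type} (t : Finset ι) (a b c : ι → Omega q) :
    ∑ i ∈ t, tri q (a i) (b i) (c i) = tri q (∑ i ∈ t, a i) (∑ i ∈ t, b i) (∑ i ∈ t, c i) := by
  ext i j; fin_cases i <;> fin_cases j <;> simp [tri, Matrix.sum_apply]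

theorem tri_one : (1 : Matrix (Fin 2) (Fin 2) (Omega q)) = tri q 1 0 1 := by
  ext i j; fin_cases i <;> fin_cases j <;> simp [tri]

theorem tri_zero : (0 : Matrix (Fin 2) (Fin 2) (Omega q)) = tri q 0 0 0 := by
  ext i j; fin_cases i <;> fin_cases j <;> simp [tri]

theorem r_left_cancel {a b : Omega q} (hab : r q * a = r q * b) : a = b := by
  have := congrArg (rinv q * ·) hab
  simpa only [← mul_assoc, rinv_r, one_mul] using this

theorem reassoc {a b c : Omega q} (hab : a * b = c) (z : Omega q) : a * (b * z) = c * z := by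
  rw [← mul_assoc, hab]

theorem r_rho : r q * rho q = (q : ℂ) • (rho q * r q) := by
  simp only [rho, Finset.mul_sum, Finset.sum_mul, Finset.smul_sum, mul_smul_comm, smul_mul_assoc,
    ← mul_assoc, r_x]
  refine Finset.sum_congr rfl fun i _ => Finset.sum_congr rfl fun j _ => ?_
  rw [mul_assoc, r_xi, mul_smul_comm, smul_comm, mul_assoc]

theorem rho_lam : rho q * lam q = ((q : ℂ) * q) • (lam q * rho q) := by
  simp only [rho, Finset.mul_sum, Finset.sum_mul, Finset.smul_sum, mul_smul_comm, smul_mul_assoc]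
  refine Finset.sum_congr rfl fun i _ => Finset.sum_congr rfl fun j _ => ?_
  rw [mul_assoc, xi_lam, mul_smul_comm, ← mul_assoc, x_lam, smul_mul_assoc, mul_assoc]
  module

theorem rho_eq (s : ℝ) (hs : 0 < s) : rho (s ^ 2) =
    (s : ℂ)⁻¹ • (x (s ^ 2) 0 * xi (s ^ 2) 2) + x (s ^ 2) 1 * xi (s ^ 2) 1
      + (s : ℂ) • (x (s ^ 2) 2 * xi (s ^ 2) 0) := by
  simp [rho, g, Fin.sum_univ_three, Real.sqrt_sq hs.le, -Complex.coe_smul]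

theorem r_sq_eq (s : ℝ) (hs : 0 < s) : r (s ^ 2) * r (s ^ 2) =
    (s : ℂ)⁻¹ • (x (s ^ 2) 0 * x (s ^ 2) 2) + x (s ^ 2) 1 * x (s ^ 2) 1
      + (s : ℂ) • (x (s ^ 2) 2 * x (s ^ 2) 0) := by
  simp [r_sq, g, Fin.sum_univ_three, Real.sqrt_sq hs.le, -Complex.coe_smul]

theorem x0_x1 (s : ℝ) : x (s ^ 2) 0 * x (s ^ 2) 1 =
    ((s : ℂ) ^ 2) • (x (s ^ 2) 1 * x (s ^ 2) 0) := by
  have := x_minus_zero (s ^ 2)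
  rwa [Complex.ofReal_pow] at this

theorem x2_x1 (s : ℝ) : x (s ^ 2) 2 * x (s ^ 2) 1 =
    ((s : ℂ) ^ 2)⁻¹ • (x (s ^ 2) 1 * x (s ^ 2) 2) := by
  have := x_plus_zero (s ^ 2)
  rwa [Complex.ofReal_pow] at this

theorem x2_x0 (s : ℝ) (hs : 0 < s) : x (s ^ 2) 2 * x (s ^ 2) 0 =
    x (s ^ 2) 0 * x (s ^ 2) 2 + ((s : ℂ) - 1 / s) • (x (s ^ 2) 1 * x (s ^ 2) 1) := by
  have := x_plus_minus (s ^ 2)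
  rwa [h_sq s hs, Complex.ofReal_sub, Complex.ofReal_div, Complex.ofReal_one] at this

theorem d_x_minus_zero (s : ℝ) (hs : 0 < s) :
    x (s ^ 2) 0 * xi (s ^ 2) 1 + xi (s ^ 2) 0 * x (s ^ 2) 1 =
    ((s : ℂ) ^ 2) • (x (s ^ 2) 1 * xi (s ^ 2) 0 + xi (s ^ 2) 1 * x (s ^ 2) 0) := by
  have e : (s : ℂ) ≠ 0 := by exact_mod_cast hs.ne'
  simp only [x0_xi1 s hs, x1_xi0 s hs]
  match_scalars <;> field_simp <;> ring

theorem d_x_plus_zero (s : ℝ) (hs : 0 < s) :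
    x (s ^ 2) 2 * xi (s ^ 2) 1 + xi (s ^ 2) 2 * x (s ^ 2) 1 =
    ((s : ℂ) ^ 2)⁻¹ • (x (s ^ 2) 1 * xi (s ^ 2) 2 + xi (s ^ 2) 1 * x (s ^ 2) 2) := by
  have e : (s : ℂ) ≠ 0 := by exact_mod_cast hs.ne'
  simp only [x2_xi1 s hs, x1_xi2 s hs]
  match_scalars <;> field_simp <;> ring

theorem d_x_plus_minus (s : ℝ) (hs : 0 < s) :
    (x (s ^ 2) 2 * xi (s ^ 2) 0 + xi (s ^ 2) 2 * x (s ^ 2) 0)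
      - (x (s ^ 2) 0 * xi (s ^ 2) 2 + xi (s ^ 2) 0 * x (s ^ 2) 2) =
    ((s : ℂ) - 1 / s) • (x (s ^ 2) 1 * xi (s ^ 2) 1 + xi (s ^ 2) 1 * x (s ^ 2) 1) := by
  have e : (s : ℂ) ≠ 0 := by exact_mod_cast hs.ne'
  simp only [x2_xi0 s hs, x0_xi2 s hs, x1_xi1 s hs]
  match_scalars <;> field_simp <;> ring

theorem d_r_sq (s : ℝ) (hs : 0 < s) :
    (1 + (s : ℂ) ^ 2) • rho (s ^ 2) = ∑ i, ∑ j, (g (s ^ 2) i j : ℂ) •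
      (x (s ^ 2) i * xi (s ^ 2) j + xi (s ^ 2) i * x (s ^ 2) j) := by
  have e : (s : ℂ) ≠ 0 := by exact_mod_cast hs.ne'
  simp only [rho_eq s hs, Fin.sum_univ_three, g, Real.sqrt_sq hs.le]
  simp [x2_xi0 s hs, x0_xi2 s hs, x1_xi1 s hs, -Complex.coe_smul]
  match_scalars <;> field_simp <;> ring

theorem rho_x (s : ℝ) (hs : 0 < s) (i : Fin 3) : rho (s ^ 2) * x (s ^ 2) i =
    x (s ^ 2) i * rho (s ^ 2) + (1 - (s : ℂ) ^ 2) • (xi (s ^ 2) i * (r (s ^ 2) * r (s ^ 2))) := by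
  have e : (s : ℂ) ≠ 0 := by exact_mod_cast hs.ne'
  have key (m : Fin 3) : m = 0 ∨ m = 1 ∨ m = 2 := by omega
  rcases key i with rfl | rfl | rfl <;>
  · simp only [rho_eq s hs, r_sq_eq s hs, mul_add, add_mul, mul_smul_comm, smul_mul_assoc,
      smul_add, mul_assoc, x0_xi0 s hs, x0_xi1 s hs, x0_xi2 s hs, x1_xi0 s hs, x1_xi1 s hs,
      x1_xi2 s hs, x2_xi0 s hs, x2_xi1 s hs, x2_xi2 s hs, reassoc (x0_xi0 s hs),
      reassoc (x0_xi1 s hs), reassoc (x0_xi2 s hs), reassoc (x1_xi0 s hs),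
      reassoc (x1_xi1 s hs), reassoc (x1_xi2 s hs), reassoc (x2_xi0 s hs),
      reassoc (x2_xi1 s hs), reassoc (x2_xi2 s hs), x0_x1 s, x2_x1 s, x2_x0 s hs,
      reassoc (x0_x1 s), reassoc (x2_x1 s), reassoc (x2_x0 s hs)]
    match_scalars <;> field_simp <;> ring

theorem rho_xi (s : ℝ) (hs : 0 < s) (i : Fin 3) : rho (s ^ 2) * xi (s ^ 2) i =
    (-(s : ℂ) ^ 4) • (xi (s ^ 2) i * rho (s ^ 2)) := by
  have e : (s : ℂ) ≠ 0 := by exact_mod_cast hs.ne'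
  have key (m : Fin 3) : m = 0 ∨ m = 1 ∨ m = 2 := by omega
  rcases key i with rfl | rfl | rfl <;>
  · simp only [rho_eq s hs, mul_add, add_mul, mul_smul_comm, smul_mul_assoc,
      smul_add, mul_assoc, x0_xi0 s hs, x0_xi1 s hs, x0_xi2 s hs, x1_xi0 s hs, x1_xi1 s hs,
      x1_xi2 s hs, x2_xi0 s hs, x2_xi1 s hs, x2_xi2 s hs, reassoc (x0_xi0 s hs),
      reassoc (x0_xi1 s hs), reassoc (x0_xi2 s hs), reassoc (x1_xi0 s hs),
      reassoc (x1_xi1 s hs), reassoc (x1_xi2 s hs), reassoc (x2_xi0 s hs),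
      reassoc (x2_xi1 s hs), reassoc (x2_xi2 s hs), xi0_xi0 s hs, xi2_xi2 s hs, xi1_xi0 s hs,
      xi2_xi1 s hs, xi2_xi0 s hs, xi1_xi1 s hs, reassoc (xi0_xi0 s hs), reassoc (xi2_xi2 s hs),
      reassoc (xi1_xi0 s hs), reassoc (xi2_xi1 s hs), reassoc (xi2_xi0 s hs),
      reassoc (xi1_xi1 s hs), zero_mul, smul_zero, add_zero, zero_add]
    match_scalars <;> field_simp <;> ring

/-- The homomorphism encoding the differential as the off-diagonal entry, on the free algebra. -/
def preD (q : ℝ) : Free →ₐ[ℂ] Matrix (Fin 2) (Fin 2) (Omega q) :=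
  FreeAlgebra.lift ℂ fun a => tri q (sGen q a) (dGen q a) (cls q a)

theorem preD_gen (a : Gen) : preD q (gen a) = tri q (sGen q a) (dGen q a) (cls q a) := by
  simp [preD, gen]

theorem sGen_x (i : Fin 3) : sGen q (.x i) = x q i := rfl
theorem sGen_dx (i : Fin 3) : sGen q (.dx i) = -xi q i := rfl
theorem sGen_x0inv : sGen q .x0inv = x0inv q := rfl
theorem sGen_r : sGen q .r = r q := rfl
theorem sGen_rinv : sGen q .rinv = rinv q := rfl
theorem sGen_lam : sGen q .lam = lam q := rfl
theorem sGen_laminv : sGen q .laminv = laminv q := rfl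
theorem cls_x (i : Fin 3) : cls q (.x i) = x q i := rfl
theorem cls_dx (i : Fin 3) : cls q (.dx i) = xi q i := rfl
theorem cls_x0inv : cls q .x0inv = x0inv q := rfl
theorem cls_r : cls q .r = r q := rfl
theorem cls_rinv : cls q .rinv = rinv q := rfl
theorem cls_lam : cls q .lam = lam q := rfl
theorem cls_laminv : cls q .laminv = laminv q := rfl
theorem dGen_x (i : Fin 3) : dGen q (.x i) = xi q i := rfl
theorem dGen_dx (i : Fin 3) : dGen q (.dx i) = 0 := rfl
theorem dGen_lam : dGen q .lam = 0 := rfl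
theorem dGen_laminv : dGen q .laminv = 0 := rfl

/-- The 2-form part of the relations `x ξ = q R̂ ξ x`: `(1 + q R̂) ξ ξ = 0`. -/
theorem xi_xi_Rhat (hq : 0 < q) (i j : Fin 3) : xi q i * xi q j =
    -((q : ℂ) • ∑ k, ∑ l, (Rhat q (i, j) (k, l) : ℂ) • (xi q k * xi q l)) := by
  obtain ⟨s, hs, rfl⟩ : ∃ s : ℝ, 0 < s ∧ q = s ^ 2 :=
    ⟨√q, Real.sqrt_pos.mpr hq, (Real.sq_sqrt hq.le).symm⟩
  have e : (s : ℂ) ≠ 0 := by exact_mod_cast hs.ne'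
  have h1 := xi_xi_s (s ^ 2) i j
  have h2 := xi_xi_t (s ^ 2) i j
  have h3 := xi_xi_table s i j
  simp only [Rhat, Matrix.add_apply, Matrix.sub_apply, Matrix.smul_apply, smul_eq_mul,
    Complex.ofReal_add, Complex.ofReal_sub, Complex.ofReal_mul, add_smul, sub_smul, mul_smul,
    Finset.sum_add_distrib, Finset.sum_sub_distrib, ← Finset.smul_sum, h1, h2, ← h3, smul_zero]
  push_cast
  match_scalars
  field_simp

theorem dr_mul_r : (q : ℂ) • (rinv q * rho q) * r q = rho q := by
  apply r_left_cancel
  rw [r_rho]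
  simp only [smul_mul_assoc, mul_smul_comm, ← mul_assoc, r_rinv, one_mul]

theorem r_mul_dr : r q * (q : ℂ) • (rinv q * rho q) = (q : ℂ) • rho q := by
  simp only [mul_smul_comm, ← mul_assoc, r_rinv, one_mul]

theorem exists_sqrt (hq : 0 < q) : ∃ s : ℝ, 0 < s ∧ q = s ^ 2 :=
  ⟨√q, Real.sqrt_pos.mpr hq, (Real.sq_sqrt hq.le).symm⟩

theorem dr_mul_lam : (q : ℂ) • (rinv q * rho q) * lam q =
    (q : ℂ) • (lam q * (q : ℂ) • (rinv q * rho q)) := by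
  apply r_left_cancel
  rw [smul_mul_assoc, mul_smul_comm, mul_smul_comm, mul_smul_comm, mul_smul_comm,
    mul_assoc (rinv q), ← mul_assoc (r q) (rinv q), r_rinv, one_mul, rho_lam,
    ← mul_assoc (r q) (lam q), r_lam, smul_mul_assoc, mul_assoc (lam q), ← mul_assoc (r q) (rinv q),
    r_rinv, one_mul]
  module

theorem rinv_x (i : Fin 3) : rinv q * x q i = x q i * rinv q := by
  apply r_left_cancel
  rw [← mul_assoc, r_rinv, one_mul, ← mul_assoc, r_x, mul_assoc, r_rinv, mul_one]

theorem dr_x (hq : 0 < q) (i : Fin 3) : r q * xi q i + (q : ℂ) • (rinv q * rho q) * x q i =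
    x q i * (q : ℂ) • (rinv q * rho q) + xi q i * r q := by
  have h1 : rho q * x q i = x q i * rho q + (1 - (q : ℂ)) • (xi q i * (r q * r q)) := by
    obtain ⟨s, hs, rfl⟩ := exists_sqrt hq
    have := rho_x s hs i
    rw [← Complex.ofReal_pow] at this
    exact this
  have h2 : rinv q * (xi q i * (r q * r q)) * (q : ℂ) • 1 = xi q i * r q := by
    apply r_left_cancel
    rw [mul_smul_comm, mul_one, mul_smul_comm, ← mul_assoc (r q) (rinv q), r_rinv, one_mul,
      ← mul_assoc (r q), r_xi, smul_mul_assoc, mul_assoc]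
  rw [smul_mul_assoc, mul_assoc, h1, mul_add, mul_smul_comm, ← mul_assoc (rinv q) (x q i), rinv_x,
    mul_assoc, mul_smul_comm, ← mul_assoc (x q i), smul_add, r_xi, ← h2, mul_smul_comm, mul_one,
    mul_assoc]
  module

theorem dr_xi (hq : 0 < q) (i : Fin 3) : (q : ℂ) • (rinv q * rho q) * xi q i =
    -((q : ℂ) • (xi q i * (q : ℂ) • (rinv q * rho q))) := by
  have h1 : rho q * xi q i = (-(q : ℂ) ^ 2) • (xi q i * rho q) := by
    obtain ⟨s, hs, rfl⟩ := exists_sqrt hq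
    have := rho_xi s hs i
    rw [show (s : ℂ) ^ 4 = (((s ^ 2 : ℝ) : ℂ)) ^ 2 by push_cast; ring] at this
    exact this
  apply r_left_cancel
  rw [smul_mul_assoc, mul_assoc, h1, mul_smul_comm, mul_neg, mul_smul_comm, mul_smul_comm,
    mul_smul_comm, mul_smul_comm, mul_smul_comm, ← mul_assoc (r q) (rinv q), r_rinv, one_mul,
    ← mul_assoc (r q) (xi q i), r_xi, smul_mul_assoc, mul_assoc (xi q i), ← mul_assoc (r q),
    r_rinv, one_mul]
  module

theorem d_xx_0 (hq : 0 < q) : x q 0 * xi q 1 + xi q 0 * x q 1 =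
    (q : ℂ) • (x q 1 * xi q 0 + xi q 1 * x q 0) := by
  obtain ⟨s, hs, rfl⟩ := exists_sqrt hq
  rw [Complex.ofReal_pow]
  exact d_x_minus_zero s hs

theorem d_xx_1 (hq : 0 < q) : x q 2 * xi q 1 + xi q 2 * x q 1 =
    (q : ℂ)⁻¹ • (x q 1 * xi q 2 + xi q 1 * x q 2) := by
  obtain ⟨s, hs, rfl⟩ := exists_sqrt hq
  rw [Complex.ofReal_pow]
  exact d_x_plus_zero s hs

theorem d_xx_2 (hq : 0 < q) :
    (x q 2 * xi q 0 + xi q 2 * x q 0) - (x q 0 * xi q 2 + xi q 0 * x q 2) =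
    (h q : ℂ) • (x q 1 * xi q 1 + xi q 1 * x q 1) := by
  obtain ⟨s, hs, rfl⟩ := exists_sqrt hq
  rw [h_sq s hs, Complex.ofReal_sub, Complex.ofReal_div, Complex.ofReal_one]
  exact d_x_plus_minus s hs

theorem d_rr (hq : 0 < q) :
    r q * (q : ℂ) • (rinv q * rho q) + (q : ℂ) • (rinv q * rho q) * r q =
    ∑ i, ∑ j, (g q i j : ℂ) • (x q i * xi q j + xi q i * x q j) := by
  rw [r_mul_dr, dr_mul_r]
  obtain ⟨s, hs, rfl⟩ := exists_sqrt hq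
  rw [← d_r_sq s hs, Complex.ofReal_pow]
  module

set_option maxHeartbeats 1000000 in
theorem preD_rel (hq : 0 < q) ⦃a b : Free⦄ (hab : Rel q a b) : preD q a = preD q b := by
  cases hab <;>
    simp only [map_mul, map_smul, map_sum, map_zero, map_one, map_sub, preD_gen, tri_mul,
      tri_add, tri_sub, tri_smul, tri_sum, tri_one, tri_zero, sGen_x, sGen_dx, sGen_x0inv, sGen_r,
      sGen_rinv, sGen_lam, sGen_laminv, cls_x, cls_dx, cls_x0inv, cls_r, cls_rinv, cls_lam,
      cls_laminv, dGen_x, dGen_dx, dGen_lam, dGen_laminv, mul_zero, zero_mul, add_zero, zero_add,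
      smul_zero, Finset.sum_const_zero, neg_mul, mul_neg, neg_neg, smul_neg,
      Finset.sum_neg_distrib] <;>
    congr 1
  case x_minus_zero.e_b => exact d_xx_0 hq
  case x_plus_zero.e_b => exact d_xx_1 hq
  case x_plus_minus.e_b => exact d_xx_2 hq
  case x_dx.e_b => exact xi_xi_Rhat hq _ _
  case r_sq.e_b => exact d_rr hq
  case r_lam.e_b => exact dr_mul_lam
  case r_x.e_b => exact dr_x hq _
  case r_dx.e_b => exact dr_xi hq _
  case r_rinv.e_b =>
    simp only [dGen, mul_neg, ← mul_assoc, mul_smul_comm, smul_mul_assoc, r_rinv, one_mul]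
    exact neg_add_cancel _
  case rinv_r.e_b =>
    simp only [dGen, neg_mul, mul_assoc, mul_smul_comm, smul_mul_assoc, rinv_r, mul_one]
    exact add_neg_cancel _
  case x0_x0inv.e_b =>
    simp only [dGen, mul_neg, ← mul_assoc, x0_x0inv, one_mul]
    exact neg_add_cancel _
  case x0inv_x0.e_b =>
    simp only [dGen, neg_mul, mul_assoc, x0inv_x0, mul_one]
    exact add_neg_cancel _
  case x_plus_minus.e_a => rw [x_plus_minus]; exact add_sub_cancel_left _ _
  case x_plus_minus.e_c => rw [x_plus_minus]; exact add_sub_cancel_left _ _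
  all_goals first
    | with_reducible exact x_minus_zero q
    | with_reducible exact x_plus_zero q
    | with_reducible exact congrArg _ (x_xi q _ _)
    | with_reducible exact x_xi q _ _
    | with_reducible exact xi_xi_s q _ _
    | with_reducible exact xi_xi_t q _ _
    | with_reducible exact x_lam q _
    | with_reducible exact xi_lam q _
    | with_reducible exact congrArg _ (xi_lam q _)
    | with_reducible exact r_lam q
    | with_reducible exact lam_laminv q
    | with_reducible exact laminv_lam q
    | with_reducible exact r_sq q
    | with_reducible exact r_x q _
    | with_reducible exact r_xi q _
    | with_reducible exact congrArg _ (r_xi q _)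
    | with_reducible exact r_rinv q
    | with_reducible exact rinv_r q
    | with_reducible exact x0_x0inv q
    | with_reducible exact x0inv_x0 q

/-- The homomorphism `ω ↦ (γ ω, d ω; 0, ω)`, where `γ` is the grading sign. -/
def matD (q : ℝ) (hq : 0 < q) : Omega q →ₐ[ℂ] Matrix (Fin 2) (Fin 2) (Omega q) :=
  RingQuot.liftAlgHom ℂ ⟨preD q, preD_rel hq⟩

/-- The exterior derivative `d` of `Ω^*(A)`: by `d_x`, `d_xi`, `d_lam`, `d_mul` and `d_d` below, it
satisfies `d x^i = ξ^i`, `dΛ = 0`, the graded Leibniz rule and `d² = 0`. -/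
def d (q : ℝ) (hq : 0 < q) : Omega q →ₗ[ℂ] Omega q where
  toFun ω := matD q hq ω 0 1
  map_add' ω η := by simp
  map_smul' k ω := by simp

/-- The algebra `A` extended by `Λ^{±1}`, `r^{±1}`, `(x⁰)⁻¹`, as the degree zero part of
`Ω^*(A)`. -/
def A (q : ℝ) : Subalgebra ℂ (Omega q) :=
  Algebra.adjoin ℂ (Set.range (x q) ∪ {x0inv q, r q, rinv q, lam q, laminv q})

/-- The subalgebra of `A` generated by `x^i`, `(x⁰)⁻¹`, `r^{±1}`, without the dilatation `Λ`. -/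
def A0 (q : ℝ) : Subalgebra ℂ (Omega q) :=
  Algebra.adjoin ℂ (Set.range (x q) ∪ {x0inv q, r q, rinv q})

/-- The `A`-bimodule `Ω^p(A)` of `p`-forms: `Ω^0 = A`, `Ω^{p+1} = Ω^p · span(ξ^i) · A`. -/
def form (q : ℝ) : ℕ → Submodule ℂ (Omega q)
  | 0 => (A q).toSubmodule
  | p + 1 => form q p * Submodule.span ℂ (Set.range (xi q)) * (A q).toSubmodule

end differential

section differential_properties

variable {q : ℝ} (hq : 0 < q)

theorem matD_mk (a : Free) : matD q hq (mk q a) = preD q a := by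
  simp only [matD, mk]
  exact RingQuot.liftAlgHom_mkAlgHom_apply ℂ (preD q) (preD_rel hq) a

theorem matD_cls (a : Gen) : matD q hq (cls q a) = tri q (sGen q a) (dGen q a) (cls q a) := by
  rw [cls, matD_mk, preD_gen, cls]

/-- The grading sign `γ`, equal to `(-1)^p` on `p`-forms. -/
def gam (ω : Omega q) : Omega q := matD q hq ω 0 0

/-- Induction over words in the generators. -/
theorem omega_induction {P : Omega q → Prop} (hs : ∀ k : ℂ, P (k • 1)) (hg : ∀ a, P (cls q a))
    (hadd : ∀ ω η, P ω → P η → P (ω + η)) (hmul : ∀ ω η, P ω → P η → P (ω * η)) (ω : Omega q) :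
    P ω := by
  obtain ⟨a, rfl⟩ := RingQuot.mkAlgHom_surjective ℂ (Rel q) ω
  change P (mk q a)
  induction a using FreeAlgebra.induction with
  | grade0 k =>
    rw [AlgHom.commutes, Algebra.algebraMap_eq_smul_one]
    exact hs k
  | grade1 a => exact hg a
  | mul a b ha hb => rw [map_mul]; exact hmul _ _ ha hb
  | add a b ha hb => rw [map_add]; exact hadd _ _ ha hb

theorem matD_eq (ω : Omega q) : matD q hq ω = tri q (gam hq ω) (d q hq ω) ω := by
  have key : ∃ a b, matD q hq ω = tri q a b ω := by
    induction ω using omega_induction with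
    | hs k => exact ⟨k • 1, k • 0, by rw [map_smul, map_one, tri_one, tri_smul]⟩
    | hg a => exact ⟨_, _, matD_cls hq a⟩
    | hadd ω η h1 h2 =>
      obtain ⟨a, b, h1⟩ := h1
      obtain ⟨a', b', h2⟩ := h2
      exact ⟨_, _, by rw [map_add, h1, h2, tri_add]⟩
    | hmul ω η h1 h2 =>
      obtain ⟨a, b, h1⟩ := h1
      obtain ⟨a', b', h2⟩ := h2
      exact ⟨_, _, by rw [map_mul, h1, h2, tri_mul]⟩
  obtain ⟨a, b, h⟩ := key
  have h1 : gam hq ω = a := by rw [gam, h]; simp [tri]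
  have h2 : d q hq ω = b := by change matD q hq ω 0 1 = b; rw [h]; simp [tri]
  rw [h, h1, h2]

theorem d_cls (a : Gen) : d q hq (cls q a) = dGen q a := by
  change matD q hq _ 0 1 = _
  rw [matD_cls]; simp [tri]

theorem gam_cls (a : Gen) : gam hq (cls q a) = sGen q a := by
  rw [gam, matD_cls]; simp [tri]

theorem d_x (i : Fin 3) : d q hq (x q i) = xi q i := d_cls hq (.x i)

theorem d_xi (i : Fin 3) : d q hq (xi q i) = 0 := d_cls hq (.dx i)

theorem d_lam : d q hq (lam q) = 0 := d_cls hq .lam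

theorem gam_mul (ω η : Omega q) : gam hq (ω * η) = gam hq ω * gam hq η := by
  conv_lhs => rw [gam, map_mul, matD_eq hq ω, matD_eq hq η, tri_mul]
  simp [tri]

theorem gam_add (ω η : Omega q) : gam hq (ω + η) = gam hq ω + gam hq η := by
  simp [gam]

theorem gam_smul (k : ℂ) (ω : Omega q) : gam hq (k • ω) = k • gam hq ω := by
  simp [gam]

theorem d_mul_gam (ω η : Omega q) : d q hq (ω * η) = gam hq ω * d q hq η + d q hq ω * η := by
  change matD q hq (ω * η) 0 1 = _
  rw [map_mul, matD_eq hq ω, matD_eq hq η, tri_mul]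
  simp [tri]

theorem gam_of_mem_A {ω : Omega q} (hω : ω ∈ A q) : gam hq ω = ω := by
  induction hω using Algebra.adjoin_induction with
  | mem ω h =>
    rcases h with ⟨i, rfl⟩ | h
    · exact gam_cls hq (.x i)
    · rcases h with rfl | rfl | rfl | rfl | rfl
      · exact gam_cls hq .x0inv
      · exact gam_cls hq .r
      · exact gam_cls hq .rinv
      · exact gam_cls hq .lam
      · exact gam_cls hq .laminv
  | algebraMap k =>
    rw [Algebra.algebraMap_eq_smul_one, gam_smul, gam, map_one, Matrix.one_apply_eq]
  | add ω η _ _ h1 h2 => rw [gam_add, h1, h2]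
  | mul ω η _ _ h1 h2 => rw [gam_mul, h1, h2]

theorem gam_of_mem_form {p : ℕ} {ω : Omega q} (hω : ω ∈ form q p) :
    gam hq ω = (-1 : ℂ) ^ p • ω := by
  induction p generalizing ω with
  | zero => rw [pow_zero, one_smul]; exact gam_of_mem_A hq hω
  | succ p ih =>
    induction hω using Submodule.mul_induction_on' with
    | mem_mul_mem a ha b hb =>
      induction ha using Submodule.mul_induction_on' with
      | mem_mul_mem u hu v hv =>
        have hv' : gam hq v = (-1 : ℂ) • v := by
          induction hv using Submodule.span_induction with
          | mem v h =>
            obtain ⟨i, rfl⟩ := h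
            rw [neg_one_smul]; exact gam_cls hq (.dx i)
          | zero => simp [gam]
          | add v w _ _ h1 h2 => rw [gam_add, h1, h2, smul_add]
          | smul k v _ h1 => rw [gam_smul, h1, smul_comm]
        rw [gam_mul, gam_mul, ih hu, hv', gam_of_mem_A hq hb, smul_mul_smul_comm, smul_mul_assoc,
          pow_succ]
      | add u _ v _ h1 h2 => rw [add_mul, gam_add, h1, h2, smul_add]
    | add u _ v _ h1 h2 => rw [gam_add, h1, h2, smul_add]

/-- The graded Leibniz rule. -/
theorem d_mul {p : ℕ} {ω : Omega q} (hω : ω ∈ form q p) (η : Omega q) :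
    d q hq (ω * η) = d q hq ω * η + (-1 : ℂ) ^ p • (ω * d q hq η) := by
  rw [d_mul_gam, gam_of_mem_form hq hω, smul_mul_assoc, add_comm]

theorem gxi_xi (hq : 0 < q) : ∑ i, ∑ j, (g q i j : ℂ) • (xi q i * xi q j) = 0 := by
  obtain ⟨s, hs, rfl⟩ := exists_sqrt hq
  have e : (s : ℂ) ≠ 0 := by exact_mod_cast hs.ne'
  simp [g, Fin.sum_univ_three, Real.sqrt_sq hs.le, xi2_xi0 s hs, xi1_xi1 s hs,
    -Complex.coe_smul, -neg_smul]
  match_scalars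
  field_simp
  ring

theorem rho_rho (hq : 0 < q) : rho q * rho q = 0 := by
  have h1 (i : Fin 3) : rho q * x q i = x q i * rho q
      + (1 - (q : ℂ)) • (xi q i * (r q * r q)) := by
    obtain ⟨s, hs, rfl⟩ := exists_sqrt hq
    have := rho_x s hs i
    rw [← Complex.ofReal_pow] at this
    exact this
  have h2 (i : Fin 3) : rho q * xi q i = (-(q : ℂ) ^ 2) • (xi q i * rho q) := by
    obtain ⟨s, hs, rfl⟩ := exists_sqrt hq
    have := rho_xi s hs i
    rw [show (s : ℂ) ^ 4 = (((s ^ 2 : ℝ) : ℂ)) ^ 2 by push_cast; ring] at this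
    exact this
  have h3 (i j : Fin 3) : rho q * (x q i * xi q j) = (-(q : ℂ) ^ 2) • (x q i * xi q j * rho q)
      + ((1 - (q : ℂ)) * q ^ 2) • (xi q i * xi q j * (r q * r q)) := by
    rw [← mul_assoc, h1, add_mul, mul_assoc (x q i), h2, smul_mul_assoc, mul_assoc (xi q i),
      mul_assoc (r q), r_xi, mul_smul_comm (q : ℂ) (r q), ← mul_assoc (r q) (xi q j), r_xi]
    simp only [mul_smul_comm, smul_mul_assoc, smul_smul, mul_assoc]
    module
  have h4 := gxi_xi hq
  have hr (z : Omega q) : z * rho q = ∑ i, ∑ j, (g q i j : ℂ) • (z * (x q i * xi q j)) := by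
    simp only [rho, Finset.mul_sum, mul_smul_comm]
  have h5 : rho q * rho q = (-(q : ℂ) ^ 2) • (rho q * rho q) := by
    calc rho q * rho q = ∑ i, ∑ j, (g q i j : ℂ) • (rho q * (x q i * xi q j)) := by
          exact hr _
      _ = (-(q : ℂ) ^ 2) • ((∑ i, ∑ j, (g q i j : ℂ) • (x q i * xi q j)) * rho q)
          + ((1 - (q : ℂ)) * q ^ 2) •
            ((∑ i, ∑ j, (g q i j : ℂ) • (xi q i * xi q j)) * (r q * r q)) := by
          simp only [h3, smul_add, Finset.sum_add_distrib, Finset.sum_mul, Finset.smul_sum,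
            smul_mul_assoc]
          congr 1 <;> exact Finset.sum_congr rfl fun i _ => Finset.sum_congr rfl fun j _ =>
            smul_comm _ _ _
      _ = _ := by rw [h4, zero_mul, smul_zero, add_zero]; rfl
  have h6 : (1 + (q : ℂ) ^ 2) • (rho q * rho q) = 0 := by
    rw [add_smul, one_smul]
    nth_rewrite 1 [h5]
    module
  refine (smul_eq_zero.mp h6).resolve_left ?_
  have : (1 : ℝ) + q ^ 2 ≠ 0 := by positivity
  exact_mod_cast this

theorem gam_rho : gam hq (rho q) = -rho q := by
  have h1 (ι : Type) (t : Finset ι) (f : ι → Omega q) :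
      gam hq (∑ i ∈ t, f i) = ∑ i ∈ t, gam hq (f i) := by simp [gam, Matrix.sum_apply]
  have h2 (i j : Fin 3) : gam hq (x q i * xi q j) = -(x q i * xi q j) := by
    rw [gam_mul, show gam hq (x q i) = x q i from gam_cls hq (.x i),
      show gam hq (xi q j) = -xi q j from gam_cls hq (.dx j), mul_neg]
  simp only [rho, h1, gam_smul, h2, smul_neg, Finset.sum_neg_distrib]

theorem d_rho : d q hq (rho q) = 0 := by
  have h2 (i j : Fin 3) : d q hq (x q i * xi q j) = xi q i * xi q j := by
    rw [d_mul_gam, d_x, d_xi, mul_zero, zero_add]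
  simp only [rho, map_sum, map_smul, h2, gxi_xi hq]

theorem gam_d_r : gam hq (dGen q .r) = -dGen q .r := by
  simp only [dGen, gam_smul, gam_mul, gam_rho]
  rw [show gam hq (rinv q) = rinv q from gam_cls hq .rinv, mul_neg, smul_neg]

theorem d_rinv : d q hq (rinv q) = -(rinv q * dGen q .r * rinv q) := d_cls hq .rinv

theorem rho_rinv : rho q * rinv q = (q : ℂ) • (rinv q * rho q) := by
  apply r_left_cancel
  rw [← mul_assoc, r_rho, smul_mul_assoc, mul_assoc, r_rinv, mul_one, mul_smul_comm, ← mul_assoc,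
    r_rinv, one_mul]

theorem d_d_r : d q hq (dGen q .r) = 0 := by
  simp only [dGen, map_smul]
  rw [d_mul_gam, d_rho, mul_zero, zero_add, d_rinv]
  simp only [dGen, neg_mul, mul_smul_comm, smul_mul_assoc, mul_assoc]
  rw [← mul_assoc (rho q) (rinv q), rho_rinv, smul_mul_assoc, mul_assoc, rho_rho hq]
  simp

/-- If `w = d u` is odd and closed and `v = u⁻¹` is even, then `d v` is odd and closed. -/
theorem d_d_inv {v w : Omega q} (hv : gam hq v = v)
    (hw' : gam hq w = -w) (hdw : d q hq w = 0)
    (hdv : d q hq v = -(v * w * v)) :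
    d q hq (-(v * w * v)) = 0 ∧ gam hq (-(v * w * v)) = v * w * v := by
  have hn (a : Omega q) : gam hq (-a) = -gam hq a := by simp [gam]
  constructor
  · rw [map_neg, d_mul_gam, d_mul_gam, hdw, hdv, gam_mul, hv, hw']
    simp [mul_assoc]
  · rw [hn, gam_mul, gam_mul, hv, hw']
    simp

theorem d_d_aux (ω : Omega q) :
    d q hq (d q hq ω) = 0 ∧ gam hq (d q hq ω) = -d q hq (gam hq ω) := by
  induction ω using omega_induction with
  | hs k =>
    have h1 : d q hq (k • 1) = 0 := by
      change matD q hq (k • 1) 0 1 = 0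
      simp
    have h2 : gam hq (k • 1 : Omega q) = k • 1 := by simp [gam]
    rw [h2, h1]
    simp [gam]
  | hg a =>
    have h0 : gam hq (0 : Omega q) = 0 := by simp [gam]
    rw [d_cls, gam_cls]
    cases a with
    | x i =>
      exact ⟨d_xi hq i, (gam_cls hq (.dx i)).trans (congrArg Neg.neg (d_x hq i).symm)⟩
    | dx i =>
      have : d q hq (sGen q (.dx i)) = 0 := by rw [sGen_dx, map_neg, d_xi, neg_zero]
      rw [this, dGen_dx, map_zero, h0, neg_zero]; exact ⟨rfl, rfl⟩
    | lam =>
      rw [sGen_lam, d_lam, dGen_lam, map_zero, h0, neg_zero]; exact ⟨rfl, rfl⟩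
    | laminv =>
      have : d q hq (laminv q) = 0 := d_cls hq .laminv
      rw [sGen_laminv, this, dGen_laminv, map_zero, h0, neg_zero]; exact ⟨rfl, rfl⟩
    | r =>
      have : d q hq (sGen q .r) = dGen q .r := d_cls hq .r
      rw [this]
      exact ⟨d_d_r hq, gam_d_r hq⟩
    | rinv =>
      have h1 : d q hq (sGen q .rinv) = -(rinv q * dGen q .r * rinv q) := d_cls hq .rinv
      have h2 := d_d_inv hq (gam_cls hq .rinv) (gam_d_r hq) (d_d_r hq) (d_cls hq .rinv)
      rw [h1, neg_neg]
      exact h2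
    | x0inv =>
      have h1 : d q hq (sGen q .x0inv) = -(x0inv q * xi q 1 * x0inv q) := d_cls hq .x0inv
      have h2 := d_d_inv hq (gam_cls hq .x0inv) (gam_cls hq (.dx 1)) (d_cls hq (.dx 1)) (d_cls hq .x0inv)
      rw [h1, neg_neg]
      exact h2
  | hadd ω η h1 h2 =>
    simp only [map_add, gam_add, h1.1, h1.2, h2.1, h2.2]
    exact ⟨add_zero _, (neg_add _ _).symm⟩
  | hmul ω η h1 h2 =>
    have h3 : gam hq (gam hq ω * d q hq η + d q hq ω * η) =
        -(gam hq (gam hq ω) * d q hq (gam hq η) + d q hq (gam hq ω) * gam hq η) := by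
      rw [gam_add, gam_mul, gam_mul, h1.2, h2.2]
      simp [add_comm]
    constructor
    · rw [d_mul_gam, map_add, d_mul_gam, d_mul_gam, h1.1, h2.1, h1.2]
      simp
    · rw [d_mul_gam, h3, gam_mul, d_mul_gam]

/-- The exterior derivative squares to zero. -/
theorem d_d (ω : Omega q) : d q hq (d q hq ω) = 0 := (d_d_aux hq ω).1

end differential_properties

/-- The matrix `θ^a_i` of the frame; `(r x⁰)⁻¹ = (x⁰)⁻¹ r⁻¹`. -/
def thetaMat (q : ℝ) : Matrix (Fin 3) (Fin 3) (Omega q) :=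
  !![x0inv q, 0, 0;
     ((√q * (q + 1) : ℝ) : ℂ) • (x0inv q * rinv q * x q 2), rinv q, 0;
     (-(√q * q * (q + 1) : ℝ) : ℂ) • (x0inv q * rinv q ^ 2 * x q 2 ^ 2),
       (-(q + 1 : ℝ) : ℂ) • (rinv q ^ 2 * x q 2), rinv q ^ 2 * x q 1]

/-- The frame `θ^a = Λ⁻¹ θ^a_i ξ^i`, with `ξ^i = d x^i`. -/
def theta (q : ℝ) (hq : 0 < q) (a : Fin 3) : Omega q :=
  laminv q * ∑ i, thetaMat q a i * d q hq (x q i)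

/-- An antilinear map of `Ω^*(A)` is an involution of the graded algebra `Ω^*(A)`, with the sign
convention `(ω η)^⋆ = ε^{p p'} η^⋆ ω^⋆` for forms of degrees `p`, `p'`
(`ε = 1`: no signs; `ε = -1`: graded signs). -/
structure IsInvolution (q : ℝ) (ε : ℤˣ) (star : Omega q →ₛₗ[starRingEnd ℂ] Omega q) : Prop where
  involutive : ∀ ω, star (star ω) = ω
  degree : ∀ p, ∀ ω ∈ form q p, star ω ∈ form q p
  mul : ∀ p p', ∀ ω ∈ form q p, ∀ η ∈ form q p',
    star (ω * η) = ((ε ^ (p * p') : ℤˣ) : ℤ) • (star η * star ω)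

/-- The prescribed values: `(x^i)^⋆ = x^j g_{ji}`, `r^⋆ = r`, `Λ^⋆ = Λ⁻¹` and
`(θ^a)^⋆ = θ^b g_{ba}`. -/
structure HasStarValues (q : ℝ) (hq : 0 < q) (star : Omega q →ₛₗ[starRingEnd ℂ] Omega q) :
    Prop where
  star_x : ∀ i, star (x q i) = ∑ j, (g q j i : ℂ) • x q j
  star_r : star (r q) = r q
  star_lam : star (lam q) = laminv q
  star_theta : ∀ a, star (theta q hq a) = ∑ b, (g q b a : ℂ) • theta q hq b

end QEucl

end

/-!
The frame `θ^a` commutes with the coordinates `x^i`, `r`, `Λ` (`Calculus.frame_x`, `frame_r`,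
`frame_lam`) and satisfies the same quadratic relations as the differentials
(`Calculus.frame_ext`). Conversely these relations of the `θ^a` imply those of the
`ξ^i = e^i_a Λ θ^a`, where `e` is the inverse of the matrix `θ^a_i` (`Frame.x_xi`, `Frame.xi_ext`).
So `Ω^*(A)` is also presented by the coordinates and the frame, and `Frame.lift` is the resulting
universal property: coordinates in an algebra `B`, and elements `t^a` of `B` that commute with them
and satisfy the relations of the quantum exterior algebra, define a homomorphism from `Ω^*(A)`
to `B`.

In this presentation the prescribed values of the involution respect the relations almost by
inspection. For `ε = 1` the involution is `Frame.lift` with values in the opposite algebra with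
conjugated scalars (`Frame.conjOp`, `starPlus`). For `ε = -1` it is multiplied on `p`-forms by
`(-1) ^ (p choose 2)`, because `(p + p') choose 2 = p choose 2 + p' choose 2 + p p'`; this sign is
a linear combination of the scalings `ξ ↦ c ξ` with `c = i` and `c = -i` (`signTwist`).
Uniqueness (`star_unique`) holds because forms are sums of products of `x^i`, `r`, `Λ`, inverses of
these, and the `θ^a`.

As the `θ^a` commute with `Λ`, the image of `ξ^i = e^i_a Λ θ^a` is
`Λ⁻² g_{ba} θ^b_j ξ^j (e^i_a)^⋆`, and the coefficients can be moved to the right of the `ξ^j`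
(`exists_coefficients`). To see that they are not constant, `Ω^*(A)` is represented such that `θ⁻`
and `θ⁰` vanish, `θ⁺` is a central element of square zero, and the coordinates are weighted shifts
that depend on a parameter `w`, with `r` and `Λ` proportional to `w` (`shiftFrame`). There `ξ⁺` is a
multiple of `(x⁰)⁻¹ r² Λ`, of degree `3` in `w`, and the other `ξ^j` vanish, whereas each `(ξ^i)^⋆`
gives a nonzero expression of degree `-1`. Neither the powers `w ^ 3` for `ξ^j` nor `w` for
`Λ⁻² ξ^j` match.
-/

noncomputable section

namespace QEucl

/-! ### Coordinates and the matrices of the frame -/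

/-- Elements `x⁻, x⁰, x⁺, (x⁰)⁻¹, r^{±1}, Λ^{±1}` of a complex algebra that satisfy the relations of
the algebra `A` extended by `Λ^{±1}`, `r^{±1}`, `(x⁰)⁻¹`, for `q = s ^ 2`. The parameter
`s = √q` makes all structure constants rational functions. The field `y` is `(x⁰)⁻¹`. -/
structure Coordinates (s : ℝ) (B : Type*) [Ring B] [Algebra ℂ B] where
  pos : 0 < s
  x : Fin 3 → B
  y : B
  r : B
  rinv : B
  lam : B
  laminv : B
  x0_x1 : x 0 * x 1 = ((s : ℂ) ^ 2) • (x 1 * x 0)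
  x2_x1 : x 2 * x 1 = ((s : ℂ) ^ 2)⁻¹ • (x 1 * x 2)
  x2_x0' : x 2 * x 0 = x 0 * x 2 + ((s : ℂ) - 1 / s) • (x 1 * x 1)
  x_lam (i : Fin 3) : x i * lam = ((s : ℂ) ^ 2) • (lam * x i)
  r_lam : r * lam = ((s : ℂ) ^ 2) • (lam * r)
  lam_laminv : lam * laminv = 1
  laminv_lam : laminv * lam = 1
  r_sq : r * r = (s : ℂ)⁻¹ • (x 0 * x 2) + x 1 * x 1 + (s : ℂ) • (x 2 * x 0)
  x_r (i : Fin 3) : x i * r = r * x i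
  r_rinv : r * rinv = 1
  rinv_r : rinv * r = 1
  x1_y : x 1 * y = 1
  y_x1 : y * x 1 = 1

theorem mul_inv_of_mul {B : Type*} [Ring B] [Algebra ℂ B] {a u v : B} {c : ℂ} (hc : c ≠ 0)
    (huv : u * v = 1) (hvu : v * u = 1) (h : a * u = c • (u * a)) : a * v = c⁻¹ • (v * a) := by
  have h1 : v * (a * u) * v = c • (v * (u * a) * v) := by rw [h]; simp
  rw [mul_assoc, mul_assoc a, huv, mul_one, ← mul_assoc v u, hvu, one_mul] at h1
  rw [h1, smul_smul, inv_mul_cancel₀ hc, one_smul]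

theorem inv_mul_of_mul {B : Type*} [Ring B] [Algebra ℂ B] {a u v : B} {c : ℂ} (hc : c ≠ 0)
    (huv : u * v = 1) (hvu : v * u = 1) (h : u * a = c • (a * u)) : v * a = c⁻¹ • (a * v) := by
  have h1 : v * (u * a) * v = c • (v * (a * u) * v) := by rw [h]; simp
  rw [← mul_assoc v u, hvu, one_mul, mul_assoc, mul_assoc a, huv, mul_one] at h1
  rw [h1, smul_smul, inv_mul_cancel₀ hc, one_smul]

theorem mul_reassoc {B : Type*} [Ring B] {a b c : B} (hab : a * b = c) (z : B) :
    a * (b * z) = c * z := by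
  rw [← mul_assoc, hab]

namespace Coordinates

variable {s : ℝ} {B : Type*} [Ring B] [Algebra ℂ B] (D : Coordinates s B)

theorem s_ne (D : Coordinates s B) : (s : ℂ) ≠ 0 := by exact_mod_cast D.pos.ne'

theorem one_add_s_sq_ne (D : Coordinates s B) : 1 + (s : ℂ) ^ 2 ≠ 0 := by
  have := D.pos
  exact_mod_cast (by positivity : 1 + s ^ 2 ≠ 0)

theorem s_sq_ne (D : Coordinates s B) : (s : ℂ) ^ 2 ≠ 0 := pow_ne_zero 2 D.s_ne

theorem x_rinv (i : Fin 3) : D.x i * D.rinv = D.rinv * D.x i := by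
  simpa using mul_inv_of_mul one_ne_zero D.r_rinv D.rinv_r (by simpa using D.x_r i)

theorem x_laminv (i : Fin 3) : D.x i * D.laminv = ((s : ℂ) ^ 2)⁻¹ • (D.laminv * D.x i) :=
  mul_inv_of_mul D.s_sq_ne D.lam_laminv D.laminv_lam (D.x_lam i)

theorem r_laminv : D.r * D.laminv = ((s : ℂ) ^ 2)⁻¹ • (D.laminv * D.r) :=
  mul_inv_of_mul D.s_sq_ne D.lam_laminv D.laminv_lam D.r_lam

theorem rinv_lam : D.rinv * D.lam = ((s : ℂ) ^ 2)⁻¹ • (D.lam * D.rinv) :=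
  inv_mul_of_mul D.s_sq_ne D.r_rinv D.rinv_r D.r_lam

theorem rinv_laminv : D.rinv * D.laminv = ((s : ℂ) ^ 2) • (D.laminv * D.rinv) := by
  simpa using inv_mul_of_mul (inv_ne_zero D.s_sq_ne) D.r_rinv D.rinv_r D.r_laminv

theorem y_lam : D.y * D.lam = ((s : ℂ) ^ 2)⁻¹ • (D.lam * D.y) :=
  inv_mul_of_mul D.s_sq_ne D.x1_y D.y_x1 (D.x_lam 1)

theorem y_laminv : D.y * D.laminv = ((s : ℂ) ^ 2) • (D.laminv * D.y) := by
  simpa using inv_mul_of_mul (inv_ne_zero D.s_sq_ne) D.x1_y D.y_x1 (D.x_laminv 1)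

theorem y_r : D.y * D.r = D.r * D.y := by
  simpa using inv_mul_of_mul one_ne_zero D.x1_y D.y_x1 (by simpa using D.x_r 1)

theorem y_rinv : D.y * D.rinv = D.rinv * D.y := by
  simpa using inv_mul_of_mul one_ne_zero D.x1_y D.y_x1 (by simpa using D.x_rinv 1)

theorem x0_y : D.x 0 * D.y = ((s : ℂ) ^ 2)⁻¹ • (D.y * D.x 0) :=
  mul_inv_of_mul D.s_sq_ne D.x1_y D.y_x1 D.x0_x1

theorem x2_y : D.x 2 * D.y = ((s : ℂ) ^ 2) • (D.y * D.x 2) := by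
  simpa using mul_inv_of_mul (inv_ne_zero D.s_sq_ne) D.x1_y D.y_x1 D.x2_x1

/-- With the metric relation for `r²`, the products `x⁻x⁺` and `x⁺x⁻` are combinations of `r²` and
`(x⁰)²`. These two rules and the `q`-commutation rules bring every word into the normal order
`Λ, r, x⁰, x^±`, with `x⁻` and `x⁺` not both present; the identities between explicit elements below
are verified by passing to normal forms. -/
theorem x0_x2 : D.x 0 * D.x 2 = (s / (1 + (s : ℂ) ^ 2)) • (D.r * D.r)
    - (s ^ 3 / (1 + (s : ℂ) ^ 2)) • (D.x 1 * D.x 1) := by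
  have e := D.s_ne
  have e2 := D.one_add_s_sq_ne
  rw [D.r_sq, D.x2_x0']
  match_scalars <;> field_simp
  ring

theorem x2_x0 : D.x 2 * D.x 0 = (s / (1 + (s : ℂ) ^ 2)) • (D.r * D.r)
    - ((s : ℂ)⁻¹ / (1 + (s : ℂ) ^ 2)) • (D.x 1 * D.x 1) := by
  have e := D.s_ne
  have e2 := D.one_add_s_sq_ne
  rw [D.x2_x0', D.x0_x2]
  match_scalars <;> field_simp
  ring

/-- The matrix `e^i_a` inverse to `θ^a_i`, so that `ξ^i = e^i_a Λ θ^a`. -/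
def eMat : Matrix (Fin 3) (Fin 3) B :=
  !![D.x 1, 0, 0;
     (-(s * (s ^ 2 + 1) / s ^ 2) : ℂ) • D.x 2, D.r, 0;
     (-(s * (s ^ 2 + 1)) : ℂ) • (D.y * (D.x 2 * D.x 2)),
       ((s ^ 2 + 1) : ℂ) • (D.y * (D.r * D.x 2)), D.y * (D.r * D.r)]

theorem commute_eMat {z : B} (hx : ∀ i, Commute z (D.x i)) (hy : Commute z D.y)
    (hr : Commute z D.r) (i a : Fin 3) : Commute z (D.eMat i a) := by
  have h1 := (hy.mul_right ((hx 2).mul_right (hx 2))).smul_right (-(s * (s ^ 2 + 1)) : ℂ)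
  have h2 := (hy.mul_right (hr.mul_right (hx 2))).smul_right ((s ^ 2 + 1) : ℂ)
  have h3 := (hx 2).smul_right (-(s * (s ^ 2 + 1) / s ^ 2) : ℂ)
  have h4 := hy.mul_right (hr.mul_right hr)
  fin_cases i <;> fin_cases a
  exacts [hx 1, Commute.zero_right _, Commute.zero_right _, h3, hr, Commute.zero_right _,
    h1, h2, h4]

/-- The matrix `θ^a_i` of the frame, in arbitrary coordinates. -/
def thMat : Matrix (Fin 3) (Fin 3) B :=
  !![D.y, 0, 0;
     (s * (s ^ 2 + 1) : ℂ) • (D.y * (D.rinv * D.x 2)), D.rinv, 0;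
     (-(s * s ^ 2 * (s ^ 2 + 1)) : ℂ) • (D.y * (D.rinv * (D.rinv * (D.x 2 * D.x 2)))),
       (-(s ^ 2 + 1) : ℂ) • (D.rinv * (D.rinv * D.x 2)), D.rinv * (D.rinv * D.x 1)]

theorem thMat_mul_eMat : D.thMat * D.eMat = 1 := by
  have e := D.s_ne
  ext i j
  fin_cases i <;> fin_cases j <;>
  simp [Matrix.mul_apply, Fin.sum_univ_three, Coordinates.eMat, thMat, mul_assoc, smul_smul,
      D.x2_x1, D.x_r, D.y_r, D.rinv_r, D.x1_y, D.y_x1, mul_reassoc D.x2_x1,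
      mul_reassoc (D.x_r _), mul_reassoc D.y_r, mul_reassoc D.y_rinv, mul_reassoc D.rinv_r,
      mul_reassoc D.x1_y, mul_reassoc D.y_x1] <;>
   match_scalars <;> field_simp <;> ring

theorem eMat_mul_thMat : D.eMat * D.thMat = 1 := by
  have e := D.s_ne
  ext i j
  fin_cases i <;> fin_cases j <;>
  simp [Matrix.mul_apply, Fin.sum_univ_three, Coordinates.eMat, thMat, mul_assoc, smul_smul,
      D.x2_y, D.x_rinv, D.y_r, D.r_rinv, D.x1_y,
      D.y_x1, mul_reassoc D.x2_y, mul_reassoc (D.x_rinv _),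
      mul_reassoc D.y_r, mul_reassoc D.y_rinv, mul_reassoc D.r_rinv] <;>
   match_scalars <;> field_simp <;> ring

set_option maxHeartbeats 1000000 in
/-- The columns of `e^i_a Λ` satisfy the relations `x ξ = q R̂ ξ x`: these relations for the `ξ^i`
follow if the `θ^a` commute with the coordinates. -/
theorem x_eMat (i j a : Fin 3) : D.x i * (D.eMat j a * D.lam) =
    ∑ k, ∑ l, (qRhatTable s i j k l : ℂ) • (D.eMat k a * D.lam * D.x l) := by
  have e := D.s_ne
  have e2 := D.one_add_s_sq_ne
  -- `Complex.coe_smul` would turn some of the complex scalars into real ones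
  fin_cases i <;> fin_cases j <;> fin_cases a <;>
  simp [Fin.sum_univ_three, Coordinates.eMat, qRhatTable, mul_assoc, smul_smul,
      -Complex.coe_smul, mul_sub, sub_mul, smul_sub, D.x0_x1, D.x2_x1, D.x0_y, D.x2_y, D.x_r,
      D.y_r, D.x0_x2, D.x2_x0, D.x_lam, D.r_lam, D.y_lam, D.x1_y, D.y_x1, mul_reassoc D.x2_x1,
      mul_reassoc D.x0_y, mul_reassoc D.x2_y, mul_reassoc (D.x_r _), mul_reassoc D.y_r,
      mul_reassoc D.x0_x2, mul_reassoc (D.x_lam _), mul_reassoc D.r_lam, mul_reassoc D.y_lam,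
      mul_reassoc D.x1_y, mul_reassoc D.y_x1] <;>
   match_scalars <;> field_simp <;> ring

end Coordinates

/-! ### The presentation of the calculus by the frame -/

/-- The quadratic relations `P_s u u = P_t u u = 0` of the quantum exterior algebra, solved for the
products that are not in the order `u⁻, u⁰, u⁺`. The `ξ^i` and the `θ^a` both satisfy them. -/
structure ExteriorRelations (s : ℝ) {B : Type*} [Ring B] [Algebra ℂ B] (u : Fin 3 → B) :
    Prop where
  u0_u0 : u 0 * u 0 = 0
  u2_u2 : u 2 * u 2 = 0
  u1_u0 : u 1 * u 0 = (-(s : ℂ) ^ 2) • (u 0 * u 1)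
  u2_u1 : u 2 * u 1 = (-(s : ℂ) ^ 2) • (u 1 * u 2)
  u2_u0 : u 2 * u 0 = (-1 : ℂ) • (u 0 * u 2)
  u1_u1 : u 1 * u 1 = ((s : ℂ) - 1 / s) • (u 0 * u 2)

namespace ExteriorRelations

variable {s : ℝ} {B : Type*} [Ring B] [Algebra ℂ B] {u : Fin 3 → B}

/-- The relations say that `u u` is in the range of `P_a`. -/
theorem sum_Pa (hu : ExteriorRelations s u) (hs : 0 < s) (i j : Fin 3) :
    ∑ k, ∑ l, (Pa (s ^ 2) (i, j) (k, l) : ℂ) • (u k * u l) = u i * u j := by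
  have e : (s : ℂ) ≠ 0 := by exact_mod_cast hs.ne'
  have e1 : (1 : ℂ) + s ^ 4 ≠ 0 := by exact_mod_cast (by positivity : 1 + s ^ 4 ≠ 0)
  have key (m : Fin 3) : m = 0 ∨ m = 1 ∨ m = 2 := by omega
  rcases key i with rfl | rfl | rfl <;> rcases key j with rfl | rfl | rfl <;>
  simp [Fin.sum_univ_three, Pa_apply s hs, relVec, h_sq s hs, -Complex.coe_smul, -neg_smul,
    hu.u0_u0, hu.u2_u2, hu.u1_u0, hu.u2_u1, hu.u2_u0, hu.u1_u1] <;>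
  match_scalars <;> field_simp <;> ring

theorem sum_Pt (hu : ExteriorRelations s u) (hs : 0 < s) (i j : Fin 3) :
    ∑ k, ∑ l, (Pt (s ^ 2) (i, j) (k, l) : ℂ) • (u k * u l) = 0 := by
  have e : (s : ℂ) ≠ 0 := by exact_mod_cast hs.ne'
  simp [Fin.sum_univ_three, Pt_apply s hs, gVec, g, Real.sqrt_sq hs.le, -Complex.coe_smul,
    -neg_smul, hu.u0_u0, hu.u2_u2, hu.u1_u0, hu.u2_u1, hu.u2_u0, hu.u1_u1]
  match_scalars
  field_simp
  ring

theorem sum_Ps (hu : ExteriorRelations s u) (hs : 0 < s) (i j : Fin 3) :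
    ∑ k, ∑ l, (Ps (s ^ 2) (i, j) (k, l) : ℂ) • (u k * u l) = 0 := by
  have h1 : ∑ k, ∑ l, (((1 : Matrix (Fin 3 × Fin 3) (Fin 3 × Fin 3) ℝ) (i, j) (k, l) : ℝ) : ℂ) •
      (u k * u l) = u i * u j := by
    rw [← Fintype.sum_prod_type' (f := fun k l =>
      (((1 : Matrix (Fin 3 × Fin 3) (Fin 3 × Fin 3) ℝ) (i, j) (k, l) : ℝ) : ℂ) • (u k * u l))]
    simp [Matrix.one_apply]
  simp only [Ps, Matrix.sub_apply, Complex.ofReal_sub, sub_smul, Finset.sum_sub_distrib, h1,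
    hu.sum_Pa hs, hu.sum_Pt hs, sub_self]

end ExteriorRelations

/-- Coordinates together with elements `t^a` that commute with them and satisfy the relations of the
quantum exterior algebra: the presentation of `Ω^*(A)` by the coordinates and the frame `θ^a`. -/
structure Frame (s : ℝ) (B : Type*) [Ring B] [Algebra ℂ B] extends Coordinates s B where
  t : Fin 3 → B
  t_ext : ExteriorRelations s t
  t_x (a i : Fin 3) : t a * x i = x i * t a
  t_r (a : Fin 3) : t a * r = r * t a
  t_lam (a : Fin 3) : t a * lam = lam * t a

namespace Frame

variable {s : ℝ} {B : Type*} [Ring B] [Algebra ℂ B] (D : Frame s B)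

theorem t_y (a : Fin 3) : D.t a * D.y = D.y * D.t a := by
  simpa using mul_inv_of_mul one_ne_zero D.x1_y D.y_x1 (by simpa using D.t_x a 1)

theorem t_laminv (a : Fin 3) : D.t a * D.laminv = D.laminv * D.t a := by
  simpa using mul_inv_of_mul one_ne_zero D.lam_laminv D.laminv_lam (by simpa using D.t_lam a)

/-- The elements `ξ^i = e^i_a Λ t^a`. -/
def xi (i : Fin 3) : B := ∑ a, D.eMat i a * D.lam * D.t a

theorem x_xi (i j : Fin 3) : D.x i * D.xi j =
    ∑ k, ∑ l, (qRhatTable s i j k l : ℂ) • (D.xi k * D.x l) := by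
  have h1 (k l : Fin 3) : D.xi k * D.x l = ∑ a, D.eMat k a * D.lam * D.x l * D.t a := by
    simp only [xi, Finset.sum_mul, mul_assoc, D.t_x]
  have h2 : D.x i * D.xi j = ∑ a, D.x i * (D.eMat j a * D.lam) * D.t a := by
    simp only [xi, Finset.mul_sum, mul_assoc]
  simp only [h1, h2, D.x_eMat, Finset.sum_mul, Finset.smul_sum, smul_mul_assoc]
  rw [Finset.sum_comm]
  exact Finset.sum_congr rfl fun k _ => Finset.sum_comm

theorem r_xi (i : Fin 3) : D.r * D.xi i = ((s : ℂ) ^ 2) • (D.xi i * D.r) := by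
  simp only [xi, Finset.mul_sum, Finset.sum_mul, Finset.smul_sum]
  refine Finset.sum_congr rfl fun a _ => ?_
  have h := D.commute_eMat (fun j => (D.x_r j).symm) D.y_r.symm rfl i a
  rw [← mul_assoc, ← mul_assoc, h.eq, mul_assoc _ D.r, D.r_lam, mul_assoc _ (D.t a), D.t_r]
  simp [mul_assoc]

theorem xi_lam (i : Fin 3) : D.xi i * D.lam = ((s : ℂ) ^ 2) • (D.lam * D.xi i) := by
  have e := D.s_ne
  fin_cases i <;>
  simp [xi, Fin.sum_univ_three, Coordinates.eMat, mul_assoc, add_mul, mul_add, smul_smul,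
    -Complex.coe_smul, D.t_lam, mul_reassoc (D.x_lam _),
    mul_reassoc D.r_lam, mul_reassoc D.y_lam] <;>
  match_scalars <;> field_simp

set_option maxHeartbeats 1000000 in
theorem xi_ext : ExteriorRelations s D.xi := by
  have e := D.s_ne
  have e2 := D.one_add_s_sq_ne
  constructor <;>
  simp [xi, Fin.sum_univ_three, Coordinates.eMat, mul_assoc, add_mul, mul_add, smul_smul,
    -Complex.coe_smul, -neg_smul, mul_reassoc (D.t_x _ _), mul_reassoc (D.t_r _),
    mul_reassoc (D.t_y _), mul_reassoc (D.t_lam _),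
    D.t_ext.u0_u0, D.t_ext.u2_u2, D.t_ext.u1_u0, D.t_ext.u2_u1, D.t_ext.u2_u0, D.t_ext.u1_u1,
      D.y_r, mul_reassoc D.x2_x1, mul_reassoc D.x2_y,
      mul_reassoc (D.x_r _), mul_reassoc D.y_r, mul_reassoc (D.x_lam _),
      mul_reassoc D.r_lam, mul_reassoc D.y_lam, mul_reassoc D.x1_y, mul_reassoc D.y_x1] <;>
   match_scalars <;> field_simp <;> ring

/-- The values on the generators of `Ω^*(A)`. -/
def onGen : Gen → B
  | .x i => D.x i
  | .x0inv => D.y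
  | .r => D.r
  | .rinv => D.rinv
  | .lam => D.lam
  | .laminv => D.laminv
  | .dx i => D.xi i

theorem lift_rel ⦃a b : Free⦄ (hab : Rel (s ^ 2) a b) :
    FreeAlgebra.lift ℂ D.onGen a = FreeAlgebra.lift ℂ D.onGen b := by
  have hs := D.pos
  cases hab <;>
    simp only [map_mul, map_smul, map_sum, map_zero, map_one, map_sub, gen,
      FreeAlgebra.lift_ι_apply, onGen, Complex.ofReal_pow]
  case x_minus_zero => exact D.x0_x1
  case x_plus_zero => exact D.x2_x1
  case x_plus_minus =>
    rw [sub_eq_iff_eq_add', D.x2_x0', h_sq s hs]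
    simp
  case x_dx i j =>
    rw [D.x_xi]
    simp only [Finset.smul_sum, smul_smul, ← qRhat_apply s hs, Complex.ofReal_mul,
      Complex.ofReal_pow]
  case dx_dx_s i j => exact D.xi_ext.sum_Ps hs i j
  case dx_dx_t i j => exact D.xi_ext.sum_Pt hs i j
  case x_lam i => exact D.x_lam i
  case dx_lam i => exact D.xi_lam i
  case r_lam => exact D.r_lam
  case lam_laminv => exact D.lam_laminv
  case laminv_lam => exact D.laminv_lam
  case r_sq =>
    rw [D.r_sq]
    simp [g, Fin.sum_univ_three, Real.sqrt_sq hs.le, -Complex.coe_smul]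
  case r_x i => exact (D.x_r i).symm
  case r_dx i => exact D.r_xi i
  case r_rinv => exact D.r_rinv
  case rinv_r => exact D.rinv_r
  case x0_x0inv => exact D.x1_y
  case x0inv_x0 => exact D.y_x1

/-- The universal property of `Ω^*(A)` in terms of the frame: a `Frame` in `B` is a homomorphism
from `Ω^*(A)` to `B`. -/
def lift : Omega (s ^ 2) →ₐ[ℂ] B := RingQuot.liftAlgHom ℂ ⟨FreeAlgebra.lift ℂ D.onGen, D.lift_rel⟩

theorem lift_cls (a : Gen) : D.lift (cls (s ^ 2) a) = D.onGen a :=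
  (RingQuot.liftAlgHom_mkAlgHom_apply ℂ _ D.lift_rel (gen a)).trans
    (FreeAlgebra.lift_ι_apply _ _)

end Frame

/-! ### The frame of a calculus -/

/-- Coordinates together with elements `u^i` that satisfy the relations of the differentials
`ξ^i`. -/
structure Calculus (s : ℝ) (B : Type*) [Ring B] [Algebra ℂ B] extends Coordinates s B where
  u : Fin 3 → B
  u_ext : ExteriorRelations s u
  x_u (i j : Fin 3) : x i * u j = ∑ k, ∑ l, (qRhatTable s i j k l : ℂ) • (u k * x l)
  r_u (i : Fin 3) : r * u i = ((s : ℂ) ^ 2) • (u i * r)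
  u_lam (i : Fin 3) : u i * lam = ((s : ℂ) ^ 2) • (lam * u i)

namespace Calculus

variable {s : ℝ} {B : Type*} [Ring B] [Algebra ℂ B] (D : Calculus s B)

theorem x0_u0 : D.x 0 * D.u 0 = ((s : ℂ) ^ 4) • (D.u 0 * D.x 0) := by
  simp [D.x_u, Fin.sum_univ_three, qRhatTable, -Complex.coe_smul]

theorem x0_u1 : D.x 0 * D.u 1 = ((s : ℂ) ^ 4 - 1) • (D.u 0 * D.x 1)
    + ((s : ℂ) ^ 2) • (D.u 1 * D.x 0) := by
  simp [D.x_u, Fin.sum_univ_three, qRhatTable, -Complex.coe_smul]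

theorem x0_u2 : D.x 0 * D.u 2 =
    (((s : ℂ) ^ 4 - 1) * (1 - ((s : ℂ) ^ 2)⁻¹)) • (D.u 0 * D.x 2)
    + (-((s : ℂ) ^ 4 - 1) / s) • (D.u 1 * D.x 1) + D.u 2 * D.x 0 := by
  simp [D.x_u, Fin.sum_univ_three, qRhatTable, -Complex.coe_smul]

theorem x1_u0 : D.x 1 * D.u 0 = ((s : ℂ) ^ 2) • (D.u 0 * D.x 1) := by
  simp [D.x_u, Fin.sum_univ_three, qRhatTable, -Complex.coe_smul]

theorem x1_u1 : D.x 1 * D.u 1 =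
    (-((s : ℂ) ^ 4 - 1) / s) • (D.u 0 * D.x 2) + ((s : ℂ) ^ 2) • (D.u 1 * D.x 1) := by
  simp [D.x_u, Fin.sum_univ_three, qRhatTable, -Complex.coe_smul]

theorem x1_u2 : D.x 1 * D.u 2 = ((s : ℂ) ^ 4 - 1) • (D.u 1 * D.x 2)
    + ((s : ℂ) ^ 2) • (D.u 2 * D.x 1) := by
  simp [D.x_u, Fin.sum_univ_three, qRhatTable, -Complex.coe_smul]

theorem x2_u0 : D.x 2 * D.u 0 = D.u 0 * D.x 2 := by
  simp [D.x_u, Fin.sum_univ_three, qRhatTable, -Complex.coe_smul]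

theorem x2_u1 : D.x 2 * D.u 1 = ((s : ℂ) ^ 2) • (D.u 1 * D.x 2) := by
  simp [D.x_u, Fin.sum_univ_three, qRhatTable, -Complex.coe_smul]

theorem x2_u2 : D.x 2 * D.u 2 = ((s : ℂ) ^ 4) • (D.u 2 * D.x 2) := by
  simp [D.x_u, Fin.sum_univ_three, qRhatTable, -Complex.coe_smul]

/-- Multiplication of an exchange rule for `x⁰` by `(x⁰)⁻¹` from both sides. -/
theorem y_mul_of_x1_mul {a b : B} (h : D.x 1 * a = ((s : ℂ) ^ 2) • (a * D.x 1) + b) :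
    D.y * a = ((s : ℂ) ^ 2)⁻¹ • (a * D.y - D.y * (b * D.y)) := by
  have e := D.s_ne
  have h1 : D.y * (D.x 1 * a) * D.y = D.y * (((s : ℂ) ^ 2) • (a * D.x 1) + b) * D.y := by rw [h]
  rw [← mul_assoc D.y, D.y_x1, one_mul, mul_add, add_mul] at h1
  simp only [mul_smul_comm, smul_mul_assoc, mul_assoc, D.x1_y, mul_one] at h1
  rw [h1]
  match_scalars <;> field_simp
  ring

theorem y_u0 : D.y * D.u 0 = ((s : ℂ) ^ 2)⁻¹ • (D.u 0 * D.y) := by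
  simpa using D.y_mul_of_x1_mul (a := D.u 0) (b := 0) (by rw [D.x1_u0, add_zero])

theorem y_u1 : D.y * D.u 1 = ((s : ℂ) ^ 2)⁻¹ • (D.u 1 * D.y)
    + (((s : ℂ) ^ 4 - 1) / (s ^ 3)) • (D.u 0 * (D.y * (D.y * D.x 2))) := by
  have e := D.s_ne
  rw [D.y_mul_of_x1_mul (a := D.u 1) ((D.x1_u1).trans (add_comm _ _))]
  simp only [mul_smul_comm, smul_mul_assoc, mul_assoc, D.x2_y, mul_reassoc D.y_u0]
  match_scalars <;> field_simp

theorem y_u2 : D.y * D.u 2 = ((s : ℂ) ^ 2)⁻¹ • (D.u 2 * D.y)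
    - (((s : ℂ) ^ 4 - 1) / s ^ 2) • (D.u 1 * (D.y * (D.y * D.x 2)))
    - (((s : ℂ) ^ 4 - 1) ^ 2 / s) • (D.u 0 * (D.y * (D.y * (D.y * (D.x 2 * D.x 2))))) := by
  have e := D.s_ne
  rw [D.y_mul_of_x1_mul (a := D.u 2) ((D.x1_u2).trans (add_comm _ _))]
  simp only [mul_smul_comm, smul_mul_assoc, mul_assoc, D.x2_y, mul_reassoc D.x2_y,
      mul_reassoc D.y_u1, add_mul]
  match_scalars <;> field_simp

theorem rinv_u (i : Fin 3) : D.rinv * D.u i = ((s : ℂ) ^ 2)⁻¹ • (D.u i * D.rinv) :=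
  inv_mul_of_mul D.s_sq_ne D.r_rinv D.rinv_r (D.r_u i)

theorem u_laminv (i : Fin 3) : D.u i * D.laminv = ((s : ℂ) ^ 2)⁻¹ • (D.laminv * D.u i) :=
  mul_inv_of_mul D.s_sq_ne D.lam_laminv D.laminv_lam (D.u_lam i)

/-- The frame `θ^a = Λ⁻¹ θ^a_i u^i`. -/
def frame (a : Fin 3) : B := D.laminv * ∑ i, D.thMat a i * D.u i

set_option maxHeartbeats 2000000 in
/-- The matrix `θ^a_i` absorbs the braiding in the relations `x ξ = q R̂ ξ x`. -/
theorem frame_x (a i : Fin 3) : D.frame a * D.x i = D.x i * D.frame a := by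
  have e := D.s_ne
  have e2 := D.one_add_s_sq_ne
  fin_cases a <;> fin_cases i <;>
  simp [frame, Fin.sum_univ_three, Coordinates.thMat, mul_assoc, add_mul, mul_add, sub_mul,
      mul_sub, smul_sub, smul_smul, -Complex.coe_smul, -neg_smul, mul_reassoc (D.x_laminv _),
      D.x1_u2, D.x2_u0, D.x2_u1, D.y_u0, D.rinv_u, mul_reassoc D.x0_u0, mul_reassoc D.x0_u1,
      mul_reassoc D.x0_u2, mul_reassoc D.x1_u0, mul_reassoc D.x1_u1, mul_reassoc D.x1_u2,
      mul_reassoc D.x2_u0, mul_reassoc D.x2_u1, mul_reassoc D.x2_u2, mul_reassoc D.y_u0,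
      mul_reassoc (D.rinv_u _), D.x0_x1, D.x2_x1, D.x0_y, D.x2_y, D.x_r, D.y_r, D.x_rinv,
      D.rinv_r, D.x0_x2, D.x2_x0, D.x1_y, D.y_x1, mul_reassoc D.x2_x1, mul_reassoc D.x0_y,
      mul_reassoc D.x2_y, mul_reassoc (D.x_r _), mul_reassoc D.y_r, mul_reassoc (D.x_rinv _),
      mul_reassoc D.y_rinv, mul_reassoc D.rinv_r, mul_reassoc D.x0_x2, mul_reassoc D.x1_y,
      mul_reassoc D.y_x1] <;>
   match_scalars <;> field_simp <;> ring

set_option maxHeartbeats 2000000 in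
/-- The frame satisfies the same quadratic relations as the differentials. -/
theorem frame_ext : ExteriorRelations s D.frame := by
  have e := D.s_ne
  have e2 := D.one_add_s_sq_ne
  constructor <;>
  simp [frame, Fin.sum_univ_three, Coordinates.thMat, mul_assoc, add_mul, mul_add, sub_mul,
      mul_sub, smul_sub, smul_smul, -Complex.coe_smul, -neg_smul, mul_reassoc (D.x_laminv _),
      mul_reassoc D.y_laminv, mul_reassoc D.rinv_laminv, mul_reassoc (D.u_laminv _),
      mul_reassoc D.u_ext.u0_u0, mul_reassoc D.u_ext.u2_u2, mul_reassoc D.u_ext.u1_u0,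
      mul_reassoc D.u_ext.u2_u1, mul_reassoc D.u_ext.u2_u0, mul_reassoc D.u_ext.u1_u1, D.x1_u2,
      D.x2_u0, D.x2_u1, D.y_u0, D.rinv_u, mul_reassoc D.x1_u0, mul_reassoc D.x1_u1,
      mul_reassoc D.x1_u2, mul_reassoc D.x2_u0, mul_reassoc D.x2_u1, mul_reassoc D.x2_u2,
      mul_reassoc D.y_u0, mul_reassoc D.y_u1, mul_reassoc D.y_u2, mul_reassoc (D.rinv_u _),
      D.x2_x1, D.x2_y, D.x_rinv, D.y_rinv, D.x1_y, D.y_x1, mul_reassoc D.x2_x1,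
      mul_reassoc D.x2_y, mul_reassoc (D.x_rinv _), mul_reassoc D.y_rinv, mul_reassoc D.x1_y,
      mul_reassoc D.y_x1] <;>
   match_scalars <;> field_simp <;> ring

theorem frame_r (a : Fin 3) : D.frame a * D.r = D.r * D.frame a := by
  have e := D.s_ne
  fin_cases a <;>
  simp [frame, Fin.sum_univ_three, Coordinates.thMat, mul_assoc, add_mul, mul_add, smul_smul,
      -Complex.coe_smul, -neg_smul, mul_reassoc D.r_laminv, mul_reassoc (D.r_u _), D.x_r, D.y_r,
      D.r_rinv, D.rinv_r, D.rinv_u, D.y_u0, D.x1_u2, D.x2_u0, D.x2_u1, mul_reassoc D.x2_u0,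
      mul_reassoc (D.rinv_u _), mul_reassoc D.y_u0, mul_reassoc (D.x_r _), mul_reassoc D.y_r,
      mul_reassoc D.y_rinv, mul_reassoc D.r_rinv, mul_reassoc D.rinv_r] <;>
   match_scalars <;> field_simp

theorem frame_lam (a : Fin 3) : D.frame a * D.lam = D.lam * D.frame a := by
  have e := D.s_ne
  fin_cases a <;>
  simp [frame, Fin.sum_univ_three, Coordinates.thMat, mul_assoc, add_mul, mul_add, smul_smul,
      -Complex.coe_smul, -neg_smul, D.u_lam, mul_reassoc (D.x_lam _), mul_reassoc D.y_lam,
      mul_reassoc D.rinv_lam, mul_reassoc D.lam_laminv, mul_reassoc D.laminv_lam] <;>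
   match_scalars <;> field_simp

/-- The frame of a calculus commutes with the coordinates. -/
def toFrame : Frame s B where
  toCoordinates := D.toCoordinates
  t := D.frame
  t_ext := D.frame_ext
  t_x := D.frame_x
  t_r := D.frame_r
  t_lam := D.frame_lam

/-- The differentials are recovered from the frame, as `e` is inverse to `θ`. -/
theorem toFrame_xi (i : Fin 3) : D.toFrame.xi i = D.u i := by
  have h (a : Fin 3) : D.eMat i a * D.lam * D.frame a = ∑ j, D.eMat i a * D.thMat a j * D.u j := by
    rw [frame, mul_assoc, ← mul_assoc D.lam, D.lam_laminv, one_mul, Finset.mul_sum]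
    simp only [mul_assoc]
  calc D.toFrame.xi i = ∑ a, ∑ j, D.eMat i a * D.thMat a j * D.u j :=
        Finset.sum_congr rfl fun a _ => h a
    _ = ∑ j, (D.eMat * D.thMat) i j * D.u j := by
        rw [Finset.sum_comm]
        simp only [Matrix.mul_apply, Finset.sum_mul]
    _ = D.u i := by simp [D.eMat_mul_thMat, Matrix.one_apply]

end Calculus

/-! ### The calculus of the quantum Euclidean space -/

section omega

variable {s : ℝ} (hs : 0 < s)

/-- The generators of `Ω^*(A)`. -/
def omegaCalculus : Calculus s (Omega (s ^ 2)) where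
  pos := hs
  x := QEucl.x (s ^ 2)
  y := x0inv (s ^ 2)
  r := QEucl.r (s ^ 2)
  rinv := QEucl.rinv (s ^ 2)
  lam := QEucl.lam (s ^ 2)
  laminv := QEucl.laminv (s ^ 2)
  x0_x1 := QEucl.x0_x1 s
  x2_x1 := QEucl.x2_x1 s
  x2_x0' := QEucl.x2_x0 s hs
  x_lam i := by rw [← Complex.ofReal_pow]; exact QEucl.x_lam (s ^ 2) i
  r_lam := by rw [← Complex.ofReal_pow]; exact QEucl.r_lam (s ^ 2)
  lam_laminv := QEucl.lam_laminv _
  laminv_lam := QEucl.laminv_lam _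
  r_sq := r_sq_eq s hs
  x_r i := (r_x (s ^ 2) i).symm
  r_rinv := QEucl.r_rinv _
  rinv_r := QEucl.rinv_r _
  x1_y := x0_x0inv _
  y_x1 := x0inv_x0 _
  u := QEucl.xi (s ^ 2)
  u_ext := ⟨xi0_xi0 s hs, xi2_xi2 s hs, xi1_xi0 s hs, xi2_xi1 s hs, xi2_xi0 s hs, xi1_xi1 s hs⟩
  x_u := x_xi_table s hs
  r_u i := by rw [← Complex.ofReal_pow]; exact r_xi (s ^ 2) i
  u_lam i := by rw [← Complex.ofReal_pow]; exact QEucl.xi_lam (s ^ 2) i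

/-- The coordinates and the frame `θ^a` of `Ω^*(A)`. -/
def omegaFrame : Frame s (Omega (s ^ 2)) := (omegaCalculus hs).toFrame

theorem omegaFrame_xi (i : Fin 3) : (omegaFrame hs).xi i = xi (s ^ 2) i :=
  (omegaCalculus hs).toFrame_xi i

theorem omegaFrame_t (hq : 0 < s ^ 2) (a : Fin 3) : (omegaFrame hs).t a = theta (s ^ 2) hq a := by
  have h : (omegaCalculus hs).thMat = thetaMat (s ^ 2) := by
    ext i j
    fin_cases i <;> fin_cases j <;>
    simp [Coordinates.thMat, thetaMat, Real.sqrt_mul_self hs.le, omegaCalculus, mul_assoc,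
        pow_two, -Complex.coe_smul]
  simp only [theta, d_x, ← h]
  rfl

theorem theta_eq (hq : 0 < s ^ 2) (a : Fin 3) : theta (s ^ 2) hq a =
    laminv (s ^ 2) * ∑ i, (omegaFrame hs).thMat a i * xi (s ^ 2) i :=
  (omegaFrame_t hs hq a).symm

end omega

namespace Frame

variable {s : ℝ} {B : Type*} [Ring B] [Algebra ℂ B] (D : Frame s B)

theorem lift_x (i : Fin 3) : D.lift (QEucl.x (s ^ 2) i) = D.x i := D.lift_cls _
theorem lift_y : D.lift (x0inv (s ^ 2)) = D.y := D.lift_cls _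
theorem lift_r : D.lift (QEucl.r (s ^ 2)) = D.r := D.lift_cls _
theorem lift_rinv : D.lift (QEucl.rinv (s ^ 2)) = D.rinv := D.lift_cls _
theorem lift_lam : D.lift (QEucl.lam (s ^ 2)) = D.lam := D.lift_cls _
theorem lift_laminv : D.lift (QEucl.laminv (s ^ 2)) = D.laminv := D.lift_cls _
theorem lift_xi (i : Fin 3) : D.lift (QEucl.xi (s ^ 2) i) = D.xi i := D.lift_cls _

theorem lift_thMat (hs : 0 < s) (a i : Fin 3) :
    D.lift ((omegaFrame hs).thMat a i) = D.thMat a i := by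
  change D.lift ((omegaCalculus hs).thMat a i) = _
  fin_cases a <;> fin_cases i <;>
  simp [Coordinates.thMat, omegaCalculus, lift_x, lift_y, lift_rinv, -Complex.coe_smul]

theorem lift_theta (hq : 0 < s ^ 2) (a : Fin 3) : D.lift (theta (s ^ 2) hq a) = D.t a := by
  have h : ∑ i, D.thMat a i * D.xi i = D.lam * D.t a := by
    calc ∑ i, D.thMat a i * D.xi i = ∑ b, (D.thMat * D.eMat) a b * (D.lam * D.t b) := by
          simp only [xi, Finset.mul_sum, Matrix.mul_apply, Finset.sum_mul, mul_assoc]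
          exact Finset.sum_comm
      _ = D.lam * D.t a := by simp [D.thMat_mul_eMat, Matrix.one_apply]
  rw [theta_eq D.pos, map_mul, map_sum, lift_laminv]
  simp only [map_mul, D.lift_thMat, lift_xi, h]
  rw [← mul_assoc, D.laminv_lam, one_mul]

end Frame

/-! ### The complex conjugate of the opposite algebra -/

/-- The opposite algebra of `B`, where the scalar `c` acts as the complex conjugate of `c`.
Antilinear antihomomorphisms to `B` are homomorphisms of complex algebras to `ConjOp B`. -/
def ConjOp (B : Type*) : Type _ := Bᵐᵒᵖ

namespace ConjOp

variable {B : Type*} [Ring B]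

instance : Ring (ConjOp B) := inferInstanceAs (Ring Bᵐᵒᵖ)

instance [Algebra ℂ B] : Algebra ℂ (ConjOp B) :=
  ((algebraMap ℂ Bᵐᵒᵖ).comp (starRingEnd ℂ)).toAlgebra' fun c z =>
    Algebra.commutes (A := Bᵐᵒᵖ) (starRingEnd ℂ c) z

/-- The identity map, an antilinear antihomomorphism. -/
def op : B ≃+ ConjOp B := MulOpposite.opAddEquiv

theorem op_mul (a b : B) : op (a * b) = op b * op a := rfl

theorem op_one : op (1 : B) = 1 := rfl

theorem op_smul [Algebra ℂ B] (c : ℂ) (a : B) : op (c • a) = starRingEnd ℂ c • op a := by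
  change op (c • a) = (algebraMap ℂ Bᵐᵒᵖ) (starRingEnd ℂ (starRingEnd ℂ c)) * MulOpposite.op a
  rw [starRingEnd_self_apply, ← Algebra.smul_def]
  rfl

end ConjOp

namespace Frame

variable {s : ℝ} {B : Type*} [Ring B] [Algebra ℂ B] (D : Frame s B)

open ConjOp in
/-- The frame `g_{ji} x^j`, `r`, `Λ⁻¹`, `g_{ba} t^b` in the conjugate opposite algebra, given by the
prescribed values of the involution. -/
def conjOp : Frame s (ConjOp B) where
  pos := D.pos
  x := ![op ((s : ℂ) • D.x 2), op (D.x 1), op ((s : ℂ)⁻¹ • D.x 0)]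
  y := op D.y
  r := op D.r
  rinv := op D.rinv
  lam := op D.laminv
  laminv := op D.lam
  x0_x1 := by
    have e := D.s_ne
    simp [op_smul, ← op_mul, D.x2_x1, smul_smul, -Complex.coe_smul]
    match_scalars
    field_simp
  x2_x1 := by
    have e := D.s_ne
    simp [op_smul, ← op_mul, D.x0_x1, smul_smul, -Complex.coe_smul]
    match_scalars
    field_simp
  x2_x0' := by
    have e := D.s_ne
    simp [op_smul, ← op_mul, D.x2_x0', smul_smul, -Complex.coe_smul]
    match_scalars <;> field_simp
  x_lam i := by
    have e := D.s_ne
    fin_cases i <;> simp [op_smul, ← op_mul, D.x_laminv, smul_smul, -Complex.coe_smul] <;>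
    match_scalars <;> field_simp
  r_lam := by
    have e := D.s_ne
    simp [op_smul, ← op_mul, D.r_laminv, smul_smul, -Complex.coe_smul]
    match_scalars
    field_simp
  lam_laminv := by rw [← op_mul, D.lam_laminv, op_one]
  laminv_lam := by rw [← op_mul, D.laminv_lam, op_one]
  r_sq := by
    have e := D.s_ne
    rw [← op_mul, D.r_sq]
    simp [op_smul, ← op_mul, smul_smul, -Complex.coe_smul]
    match_scalars <;> field_simp
  x_r i := by
    fin_cases i <;> simp [op_smul, ← op_mul, D.x_r, -Complex.coe_smul]
  r_rinv := by rw [← op_mul, D.rinv_r, op_one]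
  rinv_r := by rw [← op_mul, D.r_rinv, op_one]
  x1_y := by simp [← op_mul, D.y_x1, op_one]
  y_x1 := by simp [← op_mul, D.x1_y, op_one]
  t := ![op ((s : ℂ) • D.t 2), op (D.t 1), op ((s : ℂ)⁻¹ • D.t 0)]
  t_ext := by
    have e := D.s_ne
    have h := D.t_ext
    constructor <;>
    simp [op_smul, ← op_mul, h.u0_u0, h.u2_u2, h.u1_u0, h.u2_u1, h.u2_u0, h.u1_u1, smul_smul,
      -Complex.coe_smul, -neg_smul] <;>
    match_scalars <;> field_simp
  t_x a i := by
    fin_cases a <;> fin_cases i <;>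
      simp [op_smul, ← op_mul, D.t_x, smul_smul, mul_comm, -Complex.coe_smul]
  t_r a := by
    fin_cases a <;> simp [op_smul, ← op_mul, D.t_r, -Complex.coe_smul]
  t_lam a := by
    fin_cases a <;> simp [op_smul, ← op_mul, D.t_laminv, -Complex.coe_smul]

/-- The frame with `t^a` replaced by `c t^a`. -/
def scale (c : ℂ) : Frame s B where
  toCoordinates := D.toCoordinates
  t a := c • D.t a
  t_ext := by
    have h := D.t_ext
    constructor <;>
    simp [h.u0_u0, h.u2_u2, h.u1_u0, h.u2_u1, h.u2_u0, h.u1_u1, smul_comm _ c,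
        -Complex.coe_smul, -neg_smul]
  t_x a i := by simp [D.t_x]
  t_r a := by simp [D.t_r]
  t_lam a := by simp [D.t_lam]

theorem scale_xi (c : ℂ) (i : Fin 3) : (D.scale c).xi i = c • D.xi i := by
  simp only [xi, scale, mul_smul_comm, Finset.smul_sum]

end Frame

/-! ### The grading by the degree of forms -/

section forms

variable {q : ℝ}

theorem form_mul_A (p : ℕ) : form q p * (A q).toSubmodule ≤ form q p := by
  have hA : (A q).toSubmodule * (A q).toSubmodule = (A q).toSubmodule :=
    (A q).isIdempotentElem_toSubmodule.eq
  cases p with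
  | zero => exact hA.le
  | succ p => rw [form, mul_assoc, hA]

theorem form_mul_form (p p' : ℕ) : form q p * form q p' ≤ form q (p + p') := by
  induction p' with
  | zero => exact form_mul_A p
  | succ p' ih =>
    rw [← add_assoc, form, form, ← mul_assoc, ← mul_assoc]
    exact mul_le_mul_left (mul_le_mul_left ih _) _

theorem mul_mem_form {p p' : ℕ} {ω η : Omega q} (hω : ω ∈ form q p) (hη : η ∈ form q p') :
    ω * η ∈ form q (p + p') :=
  form_mul_form p p' (Submodule.mul_mem_mul hω hη)

theorem mem_form_zero {a : Omega q} : a ∈ form q 0 ↔ a ∈ A q := Iff.rfl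

theorem xi_mem_form (i : Fin 3) : xi q i ∈ form q 1 := by
  have hi : xi q i ∈ Submodule.span ℂ (Set.range (xi q)) := Submodule.subset_span ⟨i, rfl⟩
  have h := Submodule.mul_mem_mul
    (Submodule.mul_mem_mul (mem_form_zero.2 (one_mem (A q))) hi) (mem_form_zero.2 (one_mem (A q)))
  simpa [form] using h

theorem x_mem_A0 (i : Fin 3) : x q i ∈ A0 q := Algebra.subset_adjoin (by simp)
theorem x0inv_mem_A0 : x0inv q ∈ A0 q := Algebra.subset_adjoin (by simp)
theorem r_mem_A0 : r q ∈ A0 q := Algebra.subset_adjoin (by simp)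
theorem rinv_mem_A0 : rinv q ∈ A0 q := Algebra.subset_adjoin (by simp)
theorem A0_le_A : A0 q ≤ A q :=
  Algebra.adjoin_mono (Set.union_subset_union_right _ (by simp [Set.insert_subset_iff]))
theorem lam_mem_A : lam q ∈ A q := Algebra.subset_adjoin (by simp)
theorem laminv_mem_A : laminv q ∈ A q := Algebra.subset_adjoin (by simp)

theorem iSup_form : ⨆ p, form q p = ⊤ := by
  have h0 {p : ℕ} {ω : Omega q} (h : ω ∈ form q p) : ω ∈ ⨆ p, form q p :=
    Submodule.mem_iSup_of_mem p h
  rw [eq_top_iff]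
  rintro ω -
  induction ω using omega_induction with
  | hs k => exact Submodule.smul_mem _ _ (h0 (p := 0) (one_mem (A q)))
  | hg a =>
    cases a with
    | x i => exact h0 (p := 0) (A0_le_A (x_mem_A0 i))
    | x0inv => exact h0 (p := 0) (A0_le_A x0inv_mem_A0)
    | r => exact h0 (p := 0) (A0_le_A r_mem_A0)
    | rinv => exact h0 (p := 0) (A0_le_A rinv_mem_A0)
    | lam => exact h0 (p := 0) lam_mem_A
    | laminv => exact h0 (p := 0) laminv_mem_A
    | dx i => exact h0 (xi_mem_form i)
  | hadd ω η h1 h2 => exact add_mem h1 h2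
  | hmul ω η h1 h2 =>
    have h := Submodule.mul_mem_mul h1 h2
    simp only [Submodule.iSup_mul, Submodule.mul_iSup] at h
    exact iSup_le (fun p => iSup_le fun p' => (form_mul_form _ _).trans (le_iSup (form q) _)) h

theorem form_induction {P : Omega q → Prop} (hf : ∀ p, ∀ ω ∈ form q p, P ω)
    (hadd : ∀ ω η, P ω → P η → P (ω + η)) (ω : Omega q) : P ω := by
  have h : ω ∈ ⨆ p, form q p := by rw [iSup_form]; trivial
  exact Submodule.iSup_induction _ (motive := P) h hf (hf 0 0 (zero_mem _)) hadd

/-- A `(p + 1)`-form is a sum of products `u ξ^i a` with a `p`-form `u` and `a` in `A`. -/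
theorem form_succ_induction {p : ℕ} {P : Omega q → Prop}
    (hmul : ∀ u ∈ form q p, ∀ i, ∀ a ∈ A q, P (u * xi q i * a))
    (hadd : ∀ ω η, P ω → P η → P (ω + η)) {ω : Omega q} (hω : ω ∈ form q (p + 1)) : P ω := by
  have h0 : P 0 := by simpa using hmul 0 (zero_mem _) 0 0 (zero_mem _)
  refine Submodule.mul_induction_on hω (fun z hz a ha => ?_) hadd
  refine Submodule.mul_induction_on hz (fun u hu v hv => ?_) fun z w h1 h2 => ?_
  · induction hv using Submodule.span_induction generalizing u with
    | mem v h => obtain ⟨i, rfl⟩ := h; exact hmul u hu i a ha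
    | zero => simpa using h0
    | add v w _ _ h1 h2 => rw [mul_add, add_mul]; exact hadd _ _ (h1 u hu) (h2 u hu)
    | smul k v _ h1 =>
      rw [mul_smul_comm, ← smul_mul_assoc]
      exact h1 _ (Submodule.smul_mem _ k hu)
  · rw [add_mul]; exact hadd _ _ h1 h2

end forms

/-! ### Coefficients without the dilatation -/

section coefficients

variable {s : ℝ} (hs : 0 < s)

theorem eMat_mem_A0 (i a : Fin 3) : (omegaFrame hs).eMat i a ∈ A0 (s ^ 2) := by
  have h0 (i : Fin 3) : (omegaFrame hs).x i ∈ A0 (s ^ 2) := x_mem_A0 i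
  have hy : (omegaFrame hs).y ∈ A0 (s ^ 2) := x0inv_mem_A0
  have hr : (omegaFrame hs).r ∈ A0 (s ^ 2) := r_mem_A0
  fin_cases i <;> fin_cases a
  exacts [h0 1, zero_mem _, zero_mem _, Subalgebra.smul_mem _ (h0 2) _, hr, zero_mem _,
    Subalgebra.smul_mem _ (mul_mem hy (mul_mem (h0 2) (h0 2))) _,
    Subalgebra.smul_mem _ (mul_mem hy (mul_mem hr (h0 2))) _, mul_mem hy (mul_mem hr hr)]

theorem thMat_mem_A0 (a i : Fin 3) : (omegaFrame hs).thMat a i ∈ A0 (s ^ 2) := by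
  have h0 (i : Fin 3) : (omegaFrame hs).x i ∈ A0 (s ^ 2) := x_mem_A0 i
  have hy : (omegaFrame hs).y ∈ A0 (s ^ 2) := x0inv_mem_A0
  have hr : (omegaFrame hs).rinv ∈ A0 (s ^ 2) := rinv_mem_A0
  fin_cases a <;> fin_cases i
  exacts [hy, zero_mem _, zero_mem _, Subalgebra.smul_mem _ (mul_mem hy (mul_mem hr (h0 2))) _, hr,
    zero_mem _,
    Subalgebra.smul_mem _ (mul_mem hy (mul_mem hr (mul_mem hr (mul_mem (h0 2) (h0 2))))) _,
    Subalgebra.smul_mem _ (mul_mem hr (mul_mem hr (h0 2))) _, mul_mem hr (mul_mem hr (h0 1))]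

theorem theta_mem_form (hs : 0 < s) (hq : 0 < s ^ 2) (a : Fin 3) :
    theta (s ^ 2) hq a ∈ form (s ^ 2) 1 := by
  rw [theta_eq hs]
  refine mul_mem_form (p := 0) (p' := 1) laminv_mem_A (sum_mem fun i _ => ?_)
  exact mul_mem_form (p := 0) (p' := 1) (A0_le_A (thMat_mem_A0 hs a i)) (xi_mem_form i)

theorem xi_eq (hq : 0 < s ^ 2) (i : Fin 3) : xi (s ^ 2) i =
    ∑ a, (omegaFrame hs).eMat i a * lam (s ^ 2) * theta (s ^ 2) hq a := by
  simp only [← omegaFrame_t hs]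
  exact (omegaFrame_xi hs i).symm

/-- The right `A0`-module generated by the `ξ^i`. -/
def xiA0 (q : ℝ) : Submodule ℂ (Omega q) :=
  Submodule.span ℂ (Set.range (xi q)) * (A0 q).toSubmodule

theorem xi_mul_mem {q : ℝ} (i : Fin 3) {a : Omega q} (ha : a ∈ A0 q) : xi q i * a ∈ xiA0 q :=
  Submodule.mul_mem_mul (Submodule.subset_span ⟨i, rfl⟩) ha

theorem xiA0_mul_mem {q : ℝ} {v a : Omega q} (hv : v ∈ xiA0 q) (ha : a ∈ A0 q) :
    v * a ∈ xiA0 q := by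
  have h := Submodule.mul_mem_mul hv ((Subalgebra.mem_toSubmodule _).2 ha)
  rwa [xiA0, mul_assoc, (A0 q).isIdempotentElem_toSubmodule.eq] at h

theorem exists_of_mem_xiA0 {q : ℝ} {v : Omega q} (hv : v ∈ xiA0 q) :
    ∃ c : Fin 3 → Omega q, (∀ j, c j ∈ A0 q) ∧ v = ∑ j, xi q j * c j := by
  refine Submodule.mul_induction_on hv (fun u hu a ha => ?_) ?_
  · obtain ⟨k, rfl⟩ := (Submodule.mem_span_range_iff_exists_fun ℂ).1 hu
    exact ⟨fun j => k j • a, fun j => Subalgebra.smul_mem _ ha _, by simp [Finset.sum_mul]⟩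
  · rintro v w ⟨c, hc, rfl⟩ ⟨c', hc', rfl⟩
    exact ⟨c + c', fun j => add_mem (hc j) (hc' j), by simp [mul_add, Finset.sum_add_distrib]⟩

/-- Coefficients without `Λ` can be moved to the right of the differentials. -/
theorem A0_mul_xiA0 (hs : 0 < s) {a v : Omega (s ^ 2)} (ha : a ∈ A0 (s ^ 2))
    (hv : v ∈ xiA0 (s ^ 2)) : a * v ∈ xiA0 (s ^ 2) := by
  have hext {a : Omega (s ^ 2)} (h : ∀ i, a * xi (s ^ 2) i ∈ xiA0 (s ^ 2)) {v : Omega (s ^ 2)}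
      (hv : v ∈ xiA0 (s ^ 2)) : a * v ∈ xiA0 (s ^ 2) := by
    obtain ⟨c, hc, rfl⟩ := exists_of_mem_xiA0 hv
    rw [Finset.mul_sum]
    refine sum_mem fun j _ => ?_
    rw [← mul_assoc]
    exact xiA0_mul_mem (h j) (hc j)
  have hx := fun i => x_mem_A0 (q := s ^ 2) i
  have hy := x0inv_mem_A0 (q := s ^ 2)
  induction ha using Algebra.adjoin_induction generalizing v with
  | mem a h =>
    rcases h with ⟨i, rfl⟩ | rfl | rfl | rfl
    · refine hext (fun j => ?_) hv
      rw [x_xi_table s hs]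
      exact sum_mem fun k _ => sum_mem fun l _ => Submodule.smul_mem _ _ (xi_mul_mem k (hx l))
    · refine hext (fun j => ?_) hv
      have h0 := (omegaCalculus hs).y_u0
      have h1 := (omegaCalculus hs).y_u1
      have h2 := (omegaCalculus hs).y_u2
      simp only [omegaCalculus] at h0 h1 h2
      have key (m : Fin 3) : m = 0 ∨ m = 1 ∨ m = 2 := by omega
      rcases key j with rfl | rfl | rfl
      · rw [h0]
        exact Submodule.smul_mem _ _ (xi_mul_mem 0 hy)
      · rw [h1]
        exact add_mem (Submodule.smul_mem _ _ (xi_mul_mem 1 hy))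
          (Submodule.smul_mem _ _ (xi_mul_mem 0 (mul_mem hy (mul_mem hy (hx 2)))))
      · rw [h2]
        exact sub_mem (sub_mem (Submodule.smul_mem _ _ (xi_mul_mem 2 hy))
          (Submodule.smul_mem _ _ (xi_mul_mem 1 (mul_mem hy (mul_mem hy (hx 2))))))
          (Submodule.smul_mem _ _ (xi_mul_mem 0
            (mul_mem hy (mul_mem hy (mul_mem hy (mul_mem (hx 2) (hx 2)))))))
    · refine hext (fun j => ?_) hv
      rw [r_xi]
      exact Submodule.smul_mem _ _ (xi_mul_mem j r_mem_A0)
    · refine hext (fun j => ?_) hv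
      have h := (omegaCalculus hs).rinv_u j
      simp only [omegaCalculus] at h
      rw [h]
      exact Submodule.smul_mem _ _ (xi_mul_mem j rinv_mem_A0)
  | algebraMap k =>
    rw [← Algebra.smul_def]
    exact Submodule.smul_mem _ _ hv
  | add a b _ _ h1 h2 => rw [add_mul]; exact add_mem (h1 hv) (h2 hv)
  | mul a b _ _ h1 h2 => rw [mul_assoc]; exact h1 (h2 hv)

end coefficients

/-! ### The involution -/

section star

variable {s : ℝ} (hs : 0 < s)

/-- The involution for the sign convention `ε = 1`, an antihomomorphism. -/
def starPlus : Omega (s ^ 2) →ₛₗ[starRingEnd ℂ] Omega (s ^ 2) where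
  toFun ω := ConjOp.op.symm ((omegaFrame hs).conjOp.lift ω)
  map_add' ω η := by simp
  map_smul' c ω := by
    apply ConjOp.op.injective
    rw [ConjOp.op_smul]
    simp

theorem op_starPlus (ω : Omega (s ^ 2)) :
    ConjOp.op (starPlus hs ω) = (omegaFrame hs).conjOp.lift ω :=
  ConjOp.op.apply_symm_apply _

theorem starPlus_mul (ω η : Omega (s ^ 2)) :
    starPlus hs (ω * η) = starPlus hs η * starPlus hs ω := by
  apply ConjOp.op.injective
  simp only [ConjOp.op_mul, op_starPlus, map_mul]

theorem starPlus_one : starPlus hs 1 = 1 := by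
  apply ConjOp.op.injective
  rw [op_starPlus, map_one, ConjOp.op_one]

theorem starPlus_x (i : Fin 3) :
    starPlus hs (x (s ^ 2) i) = ∑ j, (g (s ^ 2) j i : ℂ) • x (s ^ 2) j := by
  apply ConjOp.op.injective
  rw [op_starPlus, Frame.lift_x]
  fin_cases i <;>
  simp [Frame.conjOp, g, Fin.sum_univ_three, Real.sqrt_sq hs.le, -Complex.coe_smul] <;> rfl

theorem starPlus_x0inv : starPlus hs (x0inv (s ^ 2)) = x0inv (s ^ 2) := by
  apply ConjOp.op.injective
  rw [op_starPlus, Frame.lift_y]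
  rfl

theorem starPlus_r : starPlus hs (r (s ^ 2)) = r (s ^ 2) := by
  apply ConjOp.op.injective
  rw [op_starPlus, Frame.lift_r]
  rfl

theorem starPlus_rinv : starPlus hs (rinv (s ^ 2)) = rinv (s ^ 2) := by
  apply ConjOp.op.injective
  rw [op_starPlus, Frame.lift_rinv]
  rfl

theorem starPlus_lam : starPlus hs (lam (s ^ 2)) = laminv (s ^ 2) := by
  apply ConjOp.op.injective
  rw [op_starPlus, Frame.lift_lam]
  rfl

theorem starPlus_laminv : starPlus hs (laminv (s ^ 2)) = lam (s ^ 2) := by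
  apply ConjOp.op.injective
  rw [op_starPlus, Frame.lift_laminv]
  rfl

theorem starPlus_theta (hq : 0 < s ^ 2) (a : Fin 3) : starPlus hs (theta (s ^ 2) hq a) =
    ∑ b, (g (s ^ 2) b a : ℂ) • theta (s ^ 2) hq b := by
  apply ConjOp.op.injective
  rw [op_starPlus, Frame.lift_theta]
  fin_cases a <;>
  simp [Frame.conjOp, g, Fin.sum_univ_three, Real.sqrt_sq hs.le, -Complex.coe_smul,
    omegaFrame_t hs hq]

/-- The square of the antilinear map `v_i ↦ v_j g_{ji}` is the identity, as the metric is real with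
`g_{ij} g_{ji} = 1` on its support. -/
theorem g_star_star {M : Type*} [AddCommGroup M] [Module ℂ M] (hs : 0 < s) (v : Fin 3 → M)
    (i : Fin 3) : ∑ j, (g (s ^ 2) j i : ℂ) • ∑ k, (g (s ^ 2) k j : ℂ) • v k = v i := by
  have e : (s : ℂ) ≠ 0 := by exact_mod_cast hs.ne'
  fin_cases i <;>
  simp [g, Fin.sum_univ_three, Real.sqrt_sq hs.le, -Complex.coe_smul, smul_smul, e]

theorem starPlus_starPlus (ω : Omega (s ^ 2)) : starPlus hs (starPlus hs ω) = ω := by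
  have hq : 0 < s ^ 2 := by positivity
  have hx (i : Fin 3) : starPlus hs (starPlus hs (x (s ^ 2) i)) = x (s ^ 2) i := by
    simp only [starPlus_x, map_sum, map_smulₛₗ, Complex.conj_ofReal, g_star_star hs]
  have ht (a : Fin 3) : starPlus hs (starPlus hs (theta (s ^ 2) hq a)) = theta (s ^ 2) hq a := by
    simp only [starPlus_theta, map_sum, map_smulₛₗ, Complex.conj_ofReal, g_star_star hs]
  have hA {a : Omega (s ^ 2)} (ha : a ∈ A0 (s ^ 2)) : starPlus hs (starPlus hs a) = a := by
    induction ha using Algebra.adjoin_induction with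
    | mem a h =>
      rcases h with ⟨i, rfl⟩ | rfl | rfl | rfl
      · exact hx i
      · rw [starPlus_x0inv, starPlus_x0inv]
      · rw [starPlus_r, starPlus_r]
      · rw [starPlus_rinv, starPlus_rinv]
    | algebraMap k => simp [Algebra.algebraMap_eq_smul_one, starPlus_one]
    | add a b _ _ h1 h2 => rw [map_add, map_add, h1, h2]
    | mul a b _ _ h1 h2 => rw [starPlus_mul, starPlus_mul, h1, h2]
  induction ω using omega_induction with
  | hs k => simp [starPlus_one]
  | hg a =>
    cases a with
    | x i => exact hx i
    | x0inv => exact hA x0inv_mem_A0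
    | r => exact hA r_mem_A0
    | rinv => exact hA rinv_mem_A0
    | lam => exact (congrArg _ (starPlus_lam hs)).trans (starPlus_laminv hs)
    | laminv => exact (congrArg _ (starPlus_laminv hs)).trans (starPlus_lam hs)
    | dx i =>
      rw [cls_dx, xi_eq hs hq]
      simp only [map_sum, starPlus_mul, starPlus_lam, starPlus_laminv, hA (eMat_mem_A0 hs _ _),
          ht]
  | hadd ω η h1 h2 => rw [map_add, map_add, h1, h2]
  | hmul ω η h1 h2 => rw [starPlus_mul, starPlus_mul, h1, h2]

theorem starPlus_mem_A0 {a : Omega (s ^ 2)} (ha : a ∈ A0 (s ^ 2)) : starPlus hs a ∈ A0 (s ^ 2) := by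
  induction ha using Algebra.adjoin_induction with
  | mem a h =>
    rcases h with ⟨i, rfl⟩ | rfl | rfl | rfl
    · rw [starPlus_x]
      exact sum_mem fun j _ => Subalgebra.smul_mem _ (x_mem_A0 j) _
    · rw [starPlus_x0inv]; exact x0inv_mem_A0
    · rw [starPlus_r]; exact r_mem_A0
    · rw [starPlus_rinv]; exact rinv_mem_A0
  | algebraMap k =>
    rw [Algebra.algebraMap_eq_smul_one, map_smulₛₗ, starPlus_one]
    exact Subalgebra.smul_mem _ (one_mem _) _
  | add a b _ _ h1 h2 => rw [map_add]; exact add_mem h1 h2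
  | mul a b _ _ h1 h2 => rw [starPlus_mul]; exact mul_mem h2 h1

theorem starPlus_mem_A {a : Omega (s ^ 2)} (ha : a ∈ A (s ^ 2)) : starPlus hs a ∈ A (s ^ 2) := by
  induction ha using Algebra.adjoin_induction with
  | mem a h =>
    rcases h with ⟨i, rfl⟩ | rfl | rfl | rfl | rfl | rfl
    · exact A0_le_A (starPlus_mem_A0 hs (x_mem_A0 i))
    · exact A0_le_A (starPlus_mem_A0 hs x0inv_mem_A0)
    · exact A0_le_A (starPlus_mem_A0 hs r_mem_A0)
    · exact A0_le_A (starPlus_mem_A0 hs rinv_mem_A0)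
    · rw [starPlus_lam]; exact laminv_mem_A
    · rw [starPlus_laminv]; exact lam_mem_A
  | algebraMap k =>
    rw [Algebra.algebraMap_eq_smul_one, map_smulₛₗ, starPlus_one]
    exact Subalgebra.smul_mem _ (one_mem _) _
  | add a b _ _ h1 h2 => rw [map_add]; exact add_mem h1 h2
  | mul a b _ _ h1 h2 => rw [starPlus_mul]; exact mul_mem h2 h1

theorem starPlus_xi (hq : 0 < s ^ 2) (i : Fin 3) : starPlus hs (xi (s ^ 2) i) =
    ∑ a, (∑ b, (g (s ^ 2) b a : ℂ) • theta (s ^ 2) hq b) *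
      (laminv (s ^ 2) * starPlus hs ((omegaFrame hs).eMat i a)) := by
  rw [xi_eq hs hq, map_sum]
  simp only [starPlus_mul, starPlus_lam, starPlus_theta]

theorem starPlus_mem_form {p : ℕ} {ω : Omega (s ^ 2)} (hω : ω ∈ form (s ^ 2) p) :
    starPlus hs ω ∈ form (s ^ 2) p := by
  have hq : 0 < s ^ 2 := by positivity
  induction p generalizing ω with
  | zero => exact starPlus_mem_A hs hω
  | succ p ih =>
    refine form_succ_induction (P := fun ω => starPlus hs ω ∈ form (s ^ 2) (p + 1))
        (fun u hu i a ha => ?_) (fun ω η h1 h2 => ?_) hω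
    · rw [starPlus_mul, starPlus_mul, ← zero_add (p + 1), add_comm p]
      refine mul_mem_form (starPlus_mem_A hs ha) (mul_mem_form ?_ (ih hu))
      rw [starPlus_xi hs hq]
      refine sum_mem fun a _ => mul_mem_form (p' := 0)
        (sum_mem fun b _ => Submodule.smul_mem _ _ (theta_mem_form hs hq b)) ?_
      exact mem_form_zero.2 <|
        mul_mem laminv_mem_A (A0_le_A (starPlus_mem_A0 hs (eMat_mem_A0 hs i a)))
    · rw [map_add]; exact add_mem h1 h2

/-- The endomorphism that multiplies `p`-forms by `c ^ p`. -/
def scaleForms (c : ℂ) : Omega (s ^ 2) →ₐ[ℂ] Omega (s ^ 2) := ((omegaFrame hs).scale c).lift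

theorem scaleForms_of_mem_A (c : ℂ) {a : Omega (s ^ 2)} (ha : a ∈ A (s ^ 2)) :
    scaleForms hs c a = a := by
  induction ha using Algebra.adjoin_induction with
  | mem a h =>
    rcases h with ⟨i, rfl⟩ | rfl | rfl | rfl | rfl | rfl
    exacts [Frame.lift_x _ _, Frame.lift_y _, Frame.lift_r _, Frame.lift_rinv _, Frame.lift_lam _,
      Frame.lift_laminv _]
  | algebraMap k => exact AlgHom.commutes _ _
  | add a b _ _ h1 h2 => rw [map_add, h1, h2]
  | mul a b _ _ h1 h2 => rw [map_mul, h1, h2]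

theorem scaleForms_of_mem_form (c : ℂ) {p : ℕ} {ω : Omega (s ^ 2)} (hω : ω ∈ form (s ^ 2) p) :
    scaleForms hs c ω = c ^ p • ω := by
  induction p generalizing ω with
  | zero => rw [pow_zero, one_smul]; exact scaleForms_of_mem_A hs c hω
  | succ p ih =>
    refine form_succ_induction (P := fun ω => scaleForms hs c ω = c ^ (p + 1) • ω)
        (fun u hu i a ha => ?_) (fun ω η h1 h2 => ?_) hω
    · have h : scaleForms hs c (xi (s ^ 2) i) = c • xi (s ^ 2) i := by
        rw [scaleForms, Frame.lift_xi, Frame.scale_xi, omegaFrame_xi]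
      rw [map_mul, map_mul, ih hu, h, scaleForms_of_mem_A hs c ha]
      simp only [smul_mul_assoc, mul_smul_comm, smul_smul, pow_succ]
      rw [mul_comm]
    · rw [map_add, smul_add, h1, h2]

/-- Multiplication of `p`-forms by `ε ^ (p choose 2)`. For `ε = -1` it is written through
`scaleForms`, by `sign_sum`; this avoids a proof that the sum of the `Ω^p(A)` is direct. -/
def signTwist (ε : ℤˣ) : Omega (s ^ 2) →ₗ[ℂ] Omega (s ^ 2) :=
  if ε = 1 then LinearMap.id else
    ((1 - Complex.I) / 2) • (scaleForms hs Complex.I).toLinearMap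
      + ((1 + Complex.I) / 2) • (scaleForms hs (-Complex.I)).toLinearMap

theorem succ_choose_two (n : ℕ) : (n + 1).choose 2 = n + n.choose 2 := by
  rw [Nat.choose_succ_succ' n 1, Nat.choose_one_right]

/-- The signs `1, 1, -1, -1, …` as a combination of the powers of `i` and of `-i`. -/
theorem sign_sum (p : ℕ) : (1 - Complex.I) / 2 * Complex.I ^ p
    + (1 + Complex.I) / 2 * (-Complex.I) ^ p = (-1) ^ p.choose 2 := by
  induction p using Nat.twoStepInduction with
  | zero => simp; ring
  | one =>
    simp
    linear_combination -Complex.I_sq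
  | more p ih _ =>
    rw [succ_choose_two, succ_choose_two,
      show p + 1 + (p + p.choose 2) = p.choose 2 + (2 * p + 1) by ring, pow_add (-1),
      (odd_two_mul_add_one p).neg_one_pow, ← ih]
    simp only [pow_add, neg_sq, Complex.I_sq]
    ring

theorem signTwist_of_mem_form (ε : ℤˣ) {p : ℕ} {ω : Omega (s ^ 2)} (hω : ω ∈ form (s ^ 2) p) :
    signTwist hs ε ω = ((ε ^ p.choose 2 : ℤˣ) : ℤ) • ω := by
  rcases Int.units_eq_one_or ε with rfl | rfl
  · simp [signTwist]
  · simp only [signTwist, if_neg (show (-1 : ℤˣ) ≠ 1 by decide), LinearMap.add_apply,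
      LinearMap.smul_apply, AlgHom.toLinearMap_apply, scaleForms_of_mem_form hs _ hω, smul_smul,
      ← add_smul, sign_sum]
    rw [← Int.cast_smul_eq_zsmul ℂ]
    simp

/-- The involution for the sign convention `ε`. -/
def starMap (ε : ℤˣ) : Omega (s ^ 2) →ₛₗ[starRingEnd ℂ] Omega (s ^ 2) :=
  (signTwist hs ε).comp (starPlus hs)

theorem starMap_of_mem_form (ε : ℤˣ) {p : ℕ} {ω : Omega (s ^ 2)} (hω : ω ∈ form (s ^ 2) p) :
    starMap hs ε ω = ((ε ^ p.choose 2 : ℤˣ) : ℤ) • starPlus hs ω :=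
  signTwist_of_mem_form hs ε (starPlus_mem_form hs hω)

theorem starMap_of_mem_A (ε : ℤˣ) {a : Omega (s ^ 2)} (ha : a ∈ A (s ^ 2)) :
    starMap hs ε a = starPlus hs a := by
  simpa using starMap_of_mem_form hs ε (p := 0) ha

theorem starMap_of_mem_form_one (ε : ℤˣ) {ω : Omega (s ^ 2)} (hω : ω ∈ form (s ^ 2) 1) :
    starMap hs ε ω = starPlus hs ω := by
  simpa using starMap_of_mem_form hs ε hω

theorem isInvolution_starMap (ε : ℤˣ) : IsInvolution (s ^ 2) ε (starMap hs ε) where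
  involutive ω := by
    induction ω using form_induction with
    | hf p ω hω =>
      rw [starMap_of_mem_form hs ε hω, map_zsmul,
        starMap_of_mem_form hs ε (starPlus_mem_form hs hω), starPlus_starPlus, smul_smul]
      norm_cast
      rw [Int.units_mul_self, Units.val_one, one_smul]
    | hadd ω η h1 h2 => rw [map_add, map_add, h1, h2]
  degree p ω hω := by
    rw [starMap_of_mem_form hs ε hω]
    exact zsmul_mem (starPlus_mem_form hs hω) _
  mul p p' ω hω η hη := by
    have h : (p + p').choose 2 = p * p' + (p'.choose 2 + p.choose 2) := by
      clear hη
      induction p' with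
      | zero => simp
      | succ p' ih =>
        rw [← add_assoc, succ_choose_two, ih, succ_choose_two]
        ring
    rw [starMap_of_mem_form hs ε (mul_mem_form hω hη), starMap_of_mem_form hs ε hω,
      starMap_of_mem_form hs ε hη, starPlus_mul, h, smul_mul_smul_comm, smul_smul, pow_add, pow_add,
      Units.val_mul, Units.val_mul]

theorem hasStarValues_starMap (ε : ℤˣ) (hq : 0 < s ^ 2) :
    HasStarValues (s ^ 2) hq (starMap hs ε) where
  star_x i := by rw [starMap_of_mem_A hs ε (A0_le_A (x_mem_A0 i)), starPlus_x]
  star_r := by rw [starMap_of_mem_A hs ε (A0_le_A r_mem_A0), starPlus_r]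
  star_lam := by rw [starMap_of_mem_A hs ε lam_mem_A, starPlus_lam]
  star_theta a := by rw [starMap_of_mem_form_one hs ε (theta_mem_form hs hq a), starPlus_theta]

/-- An involution is determined on `A` by the values on `x^i`, `r`, `Λ`, since it preserves
inverses, and on the `ξ^i` by the values on the frame. -/
theorem star_unique (hs : 0 < s) {ε : ℤˣ} {hq : 0 < s ^ 2}
    {star star' : Omega (s ^ 2) →ₛₗ[starRingEnd ℂ] Omega (s ^ 2)}
    (h : IsInvolution (s ^ 2) ε star) (h' : IsInvolution (s ^ 2) ε star')
    (hv : HasStarValues (s ^ 2) hq star) (hv' : HasStarValues (s ^ 2) hq star') :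
    star' = star := by
  have mulA {σ : Omega (s ^ 2) →ₛₗ[starRingEnd ℂ] Omega (s ^ 2)} (hσ : IsInvolution (s ^ 2) ε σ)
      {a : Omega (s ^ 2)} (ha : a ∈ A (s ^ 2)) {p : ℕ} {η : Omega (s ^ 2)}
      (hη : η ∈ form (s ^ 2) p) : σ (a * η) = σ η * σ a := by
    simpa using hσ.mul 0 p a ha η hη
  have one {σ : Omega (s ^ 2) →ₛₗ[starRingEnd ℂ] Omega (s ^ 2)}
      (hσ : IsInvolution (s ^ 2) ε σ) : σ 1 = 1 := by
    have h1 : (1 : Omega (s ^ 2)) ∈ form (s ^ 2) 0 := one_mem (A (s ^ 2))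
    have h2 := mulA hσ (one_mem _) (hσ.degree 0 1 h1)
    rwa [one_mul, hσ.involutive, one_mul, eq_comm] at h2
  have inv {u v : Omega (s ^ 2)} (hu : u ∈ A (s ^ 2)) (hvA : v ∈ A (s ^ 2)) (huv : u * v = 1)
      (hvu : v * u = 1) (e : star' u = star u) : star' v = star v := by
    have e1 : star' v * star' u = 1 := by rw [← mulA h' hu (p := 0) hvA, huv, one h']
    have e2 : star u * star v = 1 := by rw [← mulA h hvA (p := 0) hu, hvu, one h]
    calc star' v = star' v * (star u * star v) := by rw [e2, mul_one]
      _ = star v := by rw [← mul_assoc, ← e, e1, one_mul]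
  have hx (i : Fin 3) : star' (x (s ^ 2) i) = star (x (s ^ 2) i) := by rw [hv.star_x, hv'.star_x]
  have hr : star' (r (s ^ 2)) = star (r (s ^ 2)) := by rw [hv.star_r, hv'.star_r]
  have hl : star' (lam (s ^ 2)) = star (lam (s ^ 2)) := by rw [hv.star_lam, hv'.star_lam]
  have hA {a : Omega (s ^ 2)} (ha : a ∈ A (s ^ 2)) : star' a = star a := by
    induction ha using Algebra.adjoin_induction with
    | mem a hm =>
      rcases hm with ⟨i, rfl⟩ | rfl | rfl | rfl | rfl | rfl
      · exact hx i
      · exact inv (A0_le_A (x_mem_A0 1)) (A0_le_A x0inv_mem_A0) (x0_x0inv _) (x0inv_x0 _) (hx 1)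
      · exact hr
      · exact inv (A0_le_A r_mem_A0) (A0_le_A rinv_mem_A0) (r_rinv _) (rinv_r _) hr
      · exact hl
      · exact inv lam_mem_A laminv_mem_A (lam_laminv _) (laminv_lam _) hl
    | algebraMap k =>
      rw [Algebra.algebraMap_eq_smul_one, map_smulₛₗ, map_smulₛₗ, one h, one h']
    | add a b _ _ h1 h2 => rw [map_add, map_add, h1, h2]
    | mul a b ha hb h1 h2 =>
      rw [mulA h ha (p := 0) hb, mulA h' ha (p := 0) hb, h1, h2]
  have hxi (i : Fin 3) : star' (xi (s ^ 2) i) = star (xi (s ^ 2) i) := by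
    rw [xi_eq hs hq, map_sum, map_sum]
    refine Finset.sum_congr rfl fun a _ => ?_
    have ha : (omegaFrame hs).eMat i a * lam (s ^ 2) ∈ A (s ^ 2) :=
      mul_mem (A0_le_A (eMat_mem_A0 hs i a)) lam_mem_A
    rw [mulA h ha (theta_mem_form hs hq a), mulA h' ha (theta_mem_form hs hq a), hA ha,
      hv.star_theta, hv'.star_theta]
  have hform (p : ℕ) : ∀ ω ∈ form (s ^ 2) p, star' ω = star ω := by
    induction p with
    | zero => exact fun ω hω => hA hω
    | succ p ih =>
      intro ω hω
      refine form_succ_induction (P := fun ω => star' ω = star ω)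
        (fun u hu i a ha => ?_) (fun ω η h1 h2 => ?_) hω
      · have hui := mul_mem_form hu (xi_mem_form i)
        rw [h.mul (p + 1) 0 _ hui a ha, h'.mul (p + 1) 0 _ hui a ha,
          h.mul p 1 u hu _ (xi_mem_form i), h'.mul p 1 u hu _ (xi_mem_form i), hA ha, hxi, ih u hu]
      · rw [map_add, map_add, h1, h2]
  ext ω
  exact form_induction hform (fun ω η h1 h2 => by rw [map_add, map_add, h1, h2]) ω

/-- `(ξ^i)^⋆ = Λ⁻² ξ^j c_{ji}`: one factor `Λ⁻¹` comes from the frame and one from `Λ^⋆`. -/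
theorem exists_coefficients (hs : 0 < s) (i : Fin 3) : ∃ c : Fin 3 → Omega (s ^ 2),
    (∀ j, c j ∈ A0 (s ^ 2)) ∧
    starPlus hs (xi (s ^ 2) i) = laminv (s ^ 2) ^ 2 * ∑ j, xi (s ^ 2) j * c j := by
  have hq : 0 < s ^ 2 := by positivity
  have hθ (b : Fin 3) {a : Omega (s ^ 2)} (ha : a ∈ A0 (s ^ 2)) :
      ∃ v ∈ xiA0 (s ^ 2), theta (s ^ 2) hq b * (laminv (s ^ 2) * a) = laminv (s ^ 2) ^ 2 * v := by
    refine ⟨(∑ k, (omegaFrame hs).thMat b k * xi (s ^ 2) k) * a, xiA0_mul_mem (sum_mem fun k _ =>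
      A0_mul_xiA0 hs (thMat_mem_A0 hs b k) (by
        simpa using xi_mul_mem k (one_mem (A0 (s ^ 2))))) ha, ?_⟩
    have h : theta (s ^ 2) hq b * laminv (s ^ 2) = laminv (s ^ 2) * theta (s ^ 2) hq b := by
      rw [← omegaFrame_t hs hq b]
      exact (omegaFrame hs).t_laminv b
    rw [← mul_assoc, h, theta_eq hs hq]
    simp only [mul_assoc, pow_two (laminv _)]
  choose! v hv hθv using fun b a => hθ b (a := a)
  have h : starPlus hs (xi (s ^ 2) i) = laminv (s ^ 2) ^ 2 *
      ∑ a, ∑ b, (g (s ^ 2) b a : ℂ) • v b (starPlus hs ((omegaFrame hs).eMat i a)) := by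
    rw [starPlus_xi hs hq]
    simp only [Finset.sum_mul, Finset.mul_sum, smul_mul_assoc, mul_smul_comm]
    refine Finset.sum_congr rfl fun a _ => Finset.sum_congr rfl fun b _ => ?_
    rw [hθv b _ (starPlus_mem_A0 hs (eMat_mem_A0 hs i a))]
  obtain ⟨c, hc, hsum⟩ := exists_of_mem_xiA0 (q := s ^ 2)
    (v := ∑ a, ∑ b, (g (s ^ 2) b a : ℂ) • v b (starPlus hs ((omegaFrame hs).eMat i a)))
    (sum_mem fun a _ => sum_mem fun b _ => Submodule.smul_mem _ _
      (hv b _ (starPlus_mem_A0 hs (eMat_mem_A0 hs i a))))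
  exact ⟨c, hc, by rw [h, hsum]⟩

end star

/-! ### A representation that separates the forms -/

section representation

variable {s : ℝ}

/-- The image of coordinates under a homomorphism. -/
def Coordinates.map {B C : Type*} [Ring B] [Algebra ℂ B] [Ring C] [Algebra ℂ C]
    (D : Coordinates s B) (f : B →ₐ[ℂ] C) : Coordinates s C where
  pos := D.pos
  x i := f (D.x i)
  y := f D.y
  r := f D.r
  rinv := f D.rinv
  lam := f D.lam
  laminv := f D.laminv
  x0_x1 := by simp only [← map_mul, ← map_smul, D.x0_x1]
  x2_x1 := by simp only [← map_mul, ← map_smul, D.x2_x1]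
  x2_x0' := by simp only [← map_mul, ← map_smul, ← map_add, D.x2_x0']
  x_lam i := by simp only [← map_mul, ← map_smul, D.x_lam]
  r_lam := by simp only [← map_mul, ← map_smul, D.r_lam]
  lam_laminv := by rw [← map_mul, D.lam_laminv, map_one]
  laminv_lam := by rw [← map_mul, D.laminv_lam, map_one]
  r_sq := by simp only [← map_mul, ← map_smul, ← map_add, D.r_sq]
  x_r i := by simp only [← map_mul, D.x_r]
  r_rinv := by rw [← map_mul, D.r_rinv, map_one]
  rinv_r := by rw [← map_mul, D.rinv_r, map_one]
  x1_y := by rw [← map_mul, D.x1_y, map_one]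
  y_x1 := by rw [← map_mul, D.y_x1, map_one]

/-- A weighted shift on the functions on `ℤ × ℤ`. -/
def shiftOp (c : ℤ → ℤ → ℂ) (a b : ℤ) : Module.End ℂ (ℤ → ℤ → ℂ) where
  toFun f m n := c m n * f (m + a) (n + b)
  map_add' f f' := by ext; simp [mul_add]
  map_smul' k f := by ext; simp [mul_left_comm]

theorem shiftOp_apply (c : ℤ → ℤ → ℂ) (a b : ℤ) (f : ℤ → ℤ → ℂ) (m n : ℤ) :
    shiftOp c a b f m n = c m n * f (m + a) (n + b) := rfl

/-- Coordinates by weighted shifts. With `x⁰`, `x⁻`, `r`, `Λ` as the generators of a quantum torus,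
`x⁺` is determined by the relations for `r²` and `[x⁺, x⁻]`. Here `w` is a free parameter. -/
def shiftCoordinates (hs : 0 < s) {w : ℂ} (hw : w ≠ 0) :
    Coordinates s (Module.End ℂ (ℤ → ℤ → ℂ)) :=
  have e : (s : ℂ) ≠ 0 := by exact_mod_cast hs.ne'
  have e2 : 1 + (s : ℂ) ^ 2 ≠ 0 := by exact_mod_cast (by positivity : 1 + s ^ 2 ≠ 0)
  { pos := hs
    x := ![shiftOp (fun m _ => ((s : ℂ) ^ 2) ^ (-m)) 0 1,
      shiftOp (fun m n => ((s : ℂ) ^ 2) ^ (n - m)) 0 0,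
      shiftOp (fun m n => s / (1 + (s : ℂ) ^ 2) * (w ^ 2 * ((s : ℂ) ^ 2) ^ (-m)
        - ((s : ℂ) ^ 2) ^ (n + n - 1 - m))) 0 (-1)]
    y := shiftOp (fun m n => ((s : ℂ) ^ 2) ^ (m - n)) 0 0
    r := shiftOp (fun m _ => w * ((s : ℂ) ^ 2) ^ (-m)) 0 0
    rinv := shiftOp (fun m _ => w⁻¹ * ((s : ℂ) ^ 2) ^ m) 0 0
    lam := shiftOp (fun _ _ => w) 1 0
    laminv := shiftOp (fun _ _ => w⁻¹) (-1) 0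
    x0_x1 := by
      ext f m n
      simp [shiftOp_apply, zpow_add₀, zpow_sub₀, e, -Complex.coe_smul]
      field_simp
    x2_x1 := by
      ext f m n
      simp [shiftOp_apply, zpow_add₀, zpow_sub₀, e, -Complex.coe_smul]
      field_simp
    x2_x0' := by
      ext f m n
      simp [shiftOp_apply, zpow_add₀, zpow_sub₀, e, -Complex.coe_smul]
      field_simp
      ring
    x_lam i := by
      ext f m n
      fin_cases i <;>
      simp [shiftOp_apply, zpow_add₀, zpow_sub₀, e, -Complex.coe_smul] <;>
      field_simp
    r_lam := by
      ext f m n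
      simp [shiftOp_apply, zpow_add₀, e, -Complex.coe_smul]
      field_simp
    lam_laminv := by ext f m n; simp [shiftOp_apply, hw]
    laminv_lam := by ext f m n; simp [shiftOp_apply, hw]
    r_sq := by
      ext f m n
      simp [shiftOp_apply, zpow_add₀, zpow_sub₀, e, -Complex.coe_smul]
      field_simp
      ring
    x_r i := by
      ext f m n
      fin_cases i <;> simp [shiftOp_apply] <;> ring
    r_rinv := by ext f m n; simp [shiftOp_apply]; field_simp
    rinv_r := by ext f m n; simp [shiftOp_apply]; field_simp
    x1_y := by
      ext f m n
      simp [shiftOp_apply, zpow_sub₀, e]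
      field_simp
    y_x1 := by
      ext f m n
      simp [shiftOp_apply, zpow_sub₀, e]
      field_simp }

/-- The representation of `Ω^*(A)` by dual numbers over weighted shifts in which `θ⁻` and `θ⁰`
vanish and `θ⁺` is the nilpotent element. -/
def shiftFrame (hs : 0 < s) {w : ℂ} (hw : w ≠ 0) :
    Frame s (DualNumber (Module.End ℂ (ℤ → ℤ → ℂ))) where
  toCoordinates := (shiftCoordinates hs hw).map (TrivSqZeroExt.inlAlgHom ℂ _ _)
  t := ![0, 0, DualNumber.eps]
  t_ext := by constructor <;> simp
  t_x a i := by
    fin_cases a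
    exacts [by simp, by simp, DualNumber.commute_eps_left _]
  t_r a := by
    fin_cases a
    exacts [by simp, by simp, DualNumber.commute_eps_left _]
  t_lam a := by
    fin_cases a
    exacts [by simp, by simp, DualNumber.commute_eps_left _]

/-- The coefficient of `θ⁺` in the representation `shiftFrame`, applied to the constant function `1`
and evaluated at the origin. -/
def shiftEval (hs : 0 < s) {w : ℂ} (hw : w ≠ 0) : Omega (s ^ 2) →ₗ[ℂ] ℂ where
  toFun ω := ((shiftFrame hs hw).lift ω).snd (fun _ _ => 1) 0 0
  map_add' ω η := by simp
  map_smul' k ω := by simp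

theorem shiftEval_xi (hs : 0 < s) {w : ℂ} (hw : w ≠ 0) (j : Fin 3) :
    shiftEval hs hw (xi (s ^ 2) j) = if j = 2 then w ^ 3 else 0 := by
  have e : (s : ℂ) ≠ 0 := by exact_mod_cast hs.ne'
  simp only [shiftEval, LinearMap.coe_mk, AddHom.coe_mk, Frame.lift_xi, Frame.xi]
  fin_cases j <;>
  simp [Fin.sum_univ_three, Coordinates.eMat, shiftFrame, Coordinates.map, shiftCoordinates,
    shiftOp_apply]
  ring

theorem shiftEval_laminv_xi (hs : 0 < s) {w : ℂ} (hw : w ≠ 0) (j : Fin 3) :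
    shiftEval hs hw (laminv (s ^ 2) ^ 2 * xi (s ^ 2) j) =
      if j = 2 then s ^ 4 * w else 0 := by
  have e : (s : ℂ) ≠ 0 := by exact_mod_cast hs.ne'
  simp only [shiftEval, LinearMap.coe_mk, AddHom.coe_mk, Frame.lift_xi, Frame.xi, map_mul,
      map_pow, Frame.lift_laminv]
  fin_cases j <;>
  simp [Fin.sum_univ_three, Coordinates.eMat, shiftFrame, Coordinates.map, shiftCoordinates,
    shiftOp_apply, pow_two]
  field_simp

/-- Only the component of `ξ^i` along `θ⁻` contributes, since `(θ⁻)^⋆` is a multiple of `θ⁺`. -/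
theorem shiftEval_starPlus_xi (hs : 0 < s) {w : ℂ} (hw : w ≠ 0) (i : Fin 3) :
    shiftEval hs hw (starPlus hs (xi (s ^ 2) i)) =
      ![(s : ℂ) ^ 3, -(s * (s ^ 2 + 1)), -((s ^ 2 + 1) / s ^ 2)] i * w⁻¹ := by
  have e : (s : ℂ) ≠ 0 := by exact_mod_cast hs.ne'
  have hq : 0 < s ^ 2 := by positivity
  simp only [shiftEval, LinearMap.coe_mk, AddHom.coe_mk, starPlus_xi hs hq, map_sum, map_mul,
      map_smul, Frame.lift_theta, Frame.lift_laminv]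
  have h : (omegaFrame hs).toCoordinates = (omegaCalculus hs).toCoordinates := rfl
  fin_cases i <;>
  simp [Fin.sum_univ_three, Coordinates.eMat, h, omegaCalculus, g, Real.sqrt_sq hs.le,
      starPlus_mul, starPlus_x, starPlus_x0inv, Frame.lift_x, Frame.lift_y, shiftFrame,
      Coordinates.map, shiftCoordinates, shiftOp_apply, -Complex.coe_smul] <;>
  field_simp

theorem shiftEval_starPlus_xi_ne (hs : 0 < s) (i : Fin 3) :
    ![(s : ℂ) ^ 3, -(s * (s ^ 2 + 1)), -((s ^ 2 + 1) / s ^ 2)] i ≠ 0 := by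
  have e : (s : ℂ) ≠ 0 := by exact_mod_cast hs.ne'
  have e2 : (s : ℂ) ^ 2 + 1 ≠ 0 := by exact_mod_cast (by positivity : s ^ 2 + 1 ≠ 0)
  fin_cases i <;> simp [e, e2]

theorem starPlus_xi_notMem_span (hs : 0 < s) (i : Fin 3) :
    starPlus hs (xi (s ^ 2) i) ∉ Submodule.span ℂ (Set.range (xi (s ^ 2))) := by
  intro h
  obtain ⟨c, hc⟩ := (Submodule.mem_span_range_iff_exists_fun ℂ).1 h
  have key {w : ℂ} (hw : w ≠ 0) := congrArg (shiftEval hs hw) hc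
  simp only [map_sum, map_smul, shiftEval_xi, shiftEval_starPlus_xi, smul_eq_mul, mul_ite,
      mul_zero, Finset.sum_ite_eq', Finset.mem_univ, if_true] at key
  -- the two sides depend on the parameter `w` with different powers
  have h1 := key one_ne_zero
  have h2 := key (w := 2) two_ne_zero
  apply shiftEval_starPlus_xi_ne hs i
  generalize ![(s : ℂ) ^ 3, -(s * (s ^ 2 + 1)), -((s ^ 2 + 1) / s ^ 2)] i = k at h1 h2 ⊢
  norm_num at h1 h2
  linear_combination (2 / 15) * h2 - (16 / 15) * h1

theorem starPlus_xi_notMem_span_laminv (hs : 0 < s) (i : Fin 3) :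
    starPlus hs (xi (s ^ 2) i) ∉
      Submodule.span ℂ (Set.range fun j => laminv (s ^ 2) ^ 2 * xi (s ^ 2) j) := by
  intro h
  obtain ⟨c, hc⟩ := (Submodule.mem_span_range_iff_exists_fun ℂ).1 h
  have key {w : ℂ} (hw : w ≠ 0) := congrArg (shiftEval hs hw) hc
  simp only [map_sum, map_smul, shiftEval_laminv_xi, shiftEval_starPlus_xi, smul_eq_mul,
      mul_ite, mul_zero, Finset.sum_ite_eq', Finset.mem_univ, if_true] at key
  -- the two sides depend on the parameter `w` with different powers
  have h1 := key one_ne_zero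
  have h2 := key (w := 2) two_ne_zero
  apply shiftEval_starPlus_xi_ne hs i
  generalize ![(s : ℂ) ^ 3, -(s * (s ^ 2 + 1)), -((s ^ 2 + 1) / s ^ 2)] i = k at h1 h2 ⊢
  norm_num at h1 h2
  linear_combination (2 / 3) * h2 - (4 / 3) * h1

end representation
end QEucl

end

theorem mainTheorem5 (q : ℝ) (hq : 0 < q) (ε : ℤˣ) :
    ∃ star : QEucl.Omega q →ₛₗ[starRingEnd ℂ] QEucl.Omega q,
      (QEucl.IsInvolution q ε star ∧ QEucl.HasStarValues q hq star) ∧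
      (∀ star' : QEucl.Omega q →ₛₗ[starRingEnd ℂ] QEucl.Omega q,
        QEucl.IsInvolution q ε star' → QEucl.HasStarValues q hq star' → star' = star) ∧
      (∃ c : Matrix (Fin 3) (Fin 3) (QEucl.Omega q),
        (∀ j i, c j i ∈ QEucl.A0 q) ∧
        ∀ i, star (QEucl.d q hq (QEucl.x q i)) =
          QEucl.laminv q ^ 2 * ∑ j, QEucl.d q hq (QEucl.x q j) * c j i) ∧
      (∀ i, star (QEucl.d q hq (QEucl.x q i)) ∉
        Submodule.span ℂ (Set.range fun j => QEucl.d q hq (QEucl.x q j))) ∧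
      (∀ i, star (QEucl.d q hq (QEucl.x q i)) ∉
        Submodule.span ℂ (Set.range fun j =>
          QEucl.laminv q ^ 2 * QEucl.d q hq (QEucl.x q j))) := by
  obtain ⟨s, hs, rfl⟩ := QEucl.exists_sqrt hq
  have hstar := QEucl.isInvolution_starMap hs ε
  have hvalues := QEucl.hasStarValues_starMap hs ε hq
  have hxi (i : Fin 3) := QEucl.starMap_of_mem_form_one hs ε (QEucl.xi_mem_form i)
  simp only [QEucl.d_x]
  refine ⟨QEucl.starMap hs ε, ⟨hstar, hvalues⟩,
    fun star' h' hv' => QEucl.star_unique hs hstar h' hvalues hv', ?_, fun i => ?_, fun i => ?_⟩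
  · choose c hc hsum using QEucl.exists_coefficients hs
    exact ⟨fun j i => c i j, fun j i => hc i j, fun i => (hxi i).trans (hsum i)⟩
  · rw [hxi]
    exact QEucl.starPlus_xi_notMem_span hs i
  · rw [hxi]
    exact QEucl.starPlus_xi_notMem_span_laminv hs i
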